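/- Let $\omega\in(0,1)$ and let $\boldsymbol a=(a_j)_{j\ge1}$, $\boldsymbol b=(b_j)_{j\ge1}$ be sequences of positive reals with $\inf_j a_j>0$, $\inf_j b_j>0$ and $a_1\le a_2\le\cdots$. For $s\in\mathbb N=\{1,2,\dots\}$ let $H_s$ be the reproducing kernel Hilbert space of complex-valued functions on $[0,1]^s$ with kernel $$K_s(x,y)=\sum_{h\in\mathbb Z^s}\omega^{\sum_{j=1}^s a_j|h_j|^{b_j}}\,e^{2\pi i\,h\cdot(x-y)} .$$ Let $\Lambda^{\rm all}$ be the class of all continuous linear functionals on $H_s$ and $\Lambda^{\rm std}$ the class of function evaluations $f\mapsto f(x)$, $x\in[0,1]^s$. For $\Lambda\in\{\Lambda^{\rm all},\Lambda^{\rm std}\}$ and $n\ge0$ let $$e(n,s)=\inf_{A}\ \sup_{\|f\|_{H_s}\le1}\|f-A(f)\|_{L_\infty([0,1]^s)},$$ the infimum being over all algorithms $A(f)=\sum_{k=1}^n\alpha_kL_k(f)$ with $\alpha_k\in L_\infty([0,1]^s)$ and $L_k\in\Lambda$. For $\varepsilon\in(0,1)$ the information complexity $n(\varepsilon,s)$ is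 the least $n$ with $e(n,s)\le\varepsilon$ (absolute error criterion), or with $e(n,s)\le\varepsilon\,e(0,s)$ (normalized error criterion). A function $p:\mathbb N\to(0,\infty)$ is called a rate if there are $q\in(0,1)$ and $C,C_1:\mathbb N\to(0,\infty)$ with $e(n,s)\le C(s)\,q^{(n/C_1(s))^{p(s)}}$ for all $n,s\in\mathbb N$. EXP means that a rate exists, and UEXP that a constant rate exists; $p^*(s)$ is the supremum of $p(s)$ over all rates $p$, and $p^*$ is the supremum of all constant rates. For $\kappa\ge1$, $\kappa$-EC-WT means $$\lim_{s+\log\varepsilon^{-1}\to\infty}\frac{\log n(\varepsilon,s)}{s+[\log\varepsilon^{-1}]^{\kappa}}=0\qquad(\log 0:=0),$$ and EC-WT is the case $\kappa=1$. EC-PT means that there are $c,\tau_1,\tau_2\ge0$ with $n(\varepsilon,s)\le c\,s^{\tau_1}(1+\log\varepsilon^{-1})^{\tau_2}$ for all $s\in\mathbb N$, $\varepsilon\in(0,1)$. EC-SPT means that there are $c,\tau\ge0$ with $n(\varepsilon,s)\le c\,(1+\log\varepsilon^{-1})^{\tau}$ for all $s\in\mathbb N$, $\varepsilon\in(0,1)$;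 $\tau^*$ is the infimum of all such $\tau$. Put $B(s)=\sum_{j=1}^s1/b_j$, $B=\sum_{j=1}^\infty1/b_j$ and $\alpha^*=\liminf_{j\to\infty}\frac{\log a_j}{j}\in[0,\infty]$. Then for each of the two classes $\Lambda$ and each of the two error criteria: 1. EXP holds, and $p^*(s)=1/B(s)$ for all $s\in\mathbb N$. 2. UEXP holds if and only if $B<\infty$; in that case $p^*=1/B$. 3. For every $\kappa\ge1$, $\kappa$-EC-WT holds if and only if $\lim_{j\to\infty}a_j=\infty$. 4. EC-WT and UEXP both hold if and only if $B<\infty$ and $\lim_{j\to\infty}a_j=\infty$. 5. The following are equivalent: EC-PT; EC-PT and EXP; EC-PT and UEXP; EC-SPT; EC-SPT and EXP; EC-SPT and UEXP. 6. EC-SPT and UEXP both hold if and only if $B<\infty$ and $\alpha^*>0$. In that case $\tau^*\in\left[B,\,B+\frac{\log3}{\alpha^*}\right]$ (with $\frac{\log 3}{\infty}=0$); in particular $\tau^*=B$ if $\alpha^*=\infty$. -/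

import Mathlib

open Filter Topology MeasureTheory
open scoped ENNReal

noncomputable section

namespace Korobov

/-- The closed unit cube `[0,1]^s`. -/
abbrev Cube (s : ℕ) : Type := Set.Icc (0 : Fin s → ℝ) 1

/-- Lebesgue measure on `[0,1]^s`. -/
def cubeMeasure (s : ℕ) : Measure (Cube s) :=
  (volume : Measure (Fin s → ℝ)).comap Subtype.val

/-- `ω_h = ω ^ (∑_{j ≤ s} a_j |h_j|^{b_j})`. All sequences are indexed from zero: `a j`, `b j`
stand for `a_{j+1}`, `b_{j+1}`. -/
def weight (ω : ℝ) (a b : ℕ → ℝ) {s : ℕ} (h : Fin s → ℤ) : ℝ :=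
  ω ^ (∑ j : Fin s, a j * |(h j : ℝ)| ^ b j)

/-- `exp (2 π i h · (x - y))`. -/
def character {s : ℕ} (h : Fin s → ℤ) (x y : Cube s) : ℂ :=
  Complex.exp (2 * Real.pi * Complex.I * ∑ j : Fin s, (h j : ℂ) * ((x.1 j : ℂ) - (y.1 j : ℂ)))

/-- The kernel `K_{s,a,b}(x,y) = ∑_h ω_h exp (2 π i h · (x - y))`. -/
def kernelFun (ω : ℝ) (a b : ℕ → ℝ) (s : ℕ) (x y : Cube s) : ℂ :=
  ∑' h : Fin s → ℤ, (weight ω a b h : ℂ) * character h x y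

/-- The kernel as an operator-valued matrix, the form in which Mathlib builds the reproducing
kernel Hilbert space: multiplication by `K_{s,a,b}(x,y)`. -/
def kernelMatrix (ω : Set.Ioo (0 : ℝ) 1) (a b : ℕ → ℝ) (s : ℕ) :
    Matrix (Cube s) (Cube s) (ℂ →L[ℂ] ℂ) :=
  Matrix.of fun x y => kernelFun ω a b s x y • ContinuousLinearMap.id ℂ ℂ

theorem weight_nonneg (ω : Set.Ioo (0 : ℝ) 1) (a b : ℕ → ℝ) {s : ℕ} (h : Fin s → ℤ) :
    0 ≤ weight ω a b h :=
  Real.rpow_nonneg ω.2.1.le _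

theorem character_eq {s : ℕ} (h : Fin s → ℤ) (x y z : Cube s) :
    character h x y = character h x z * star (character h y z) := by
  unfold character
  rw [Complex.star_def, ← Complex.exp_conj, ← Complex.exp_add]
  congr 1
  simp only [map_mul, map_sum, map_sub, Complex.conj_I, Complex.conj_ofReal, map_ofNat, map_intCast]
  rw [show (2 * (Real.pi : ℂ) * -Complex.I * ∑ j : Fin s, (h j : ℂ) * ((y.1 j : ℂ) - (z.1 j : ℂ)))
      = 2 * (Real.pi : ℂ) * Complex.I * ∑ j : Fin s, -((h j : ℂ) * ((y.1 j : ℂ) - (z.1 j : ℂ))) by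
    rw [Finset.sum_neg_distrib]; ring, ← mul_add, ← Finset.sum_add_distrib]
  congr 1
  exact Finset.sum_congr rfl fun j _ => by ring

theorem norm_character {s : ℕ} (h : Fin s → ℤ) (x y : Cube s) : ‖character h x y‖ = 1 := by
  unfold character
  rw [show (2 * (Real.pi : ℂ) * Complex.I * ∑ j : Fin s, (h j : ℂ) * ((x.1 j : ℂ) - (y.1 j : ℂ)))
    = ((2 * Real.pi * ∑ j : Fin s, (h j : ℝ) * (x.1 j - y.1 j) : ℝ) : ℂ) * Complex.I by
      push_cast; ring]
  exact Complex.norm_exp_ofReal_mul_I _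

theorem star_character {s : ℕ} (h : Fin s → ℤ) (x y : Cube s) :
    star (character h x y) = character h y x := by
  rw [character_eq h x y x, character_eq h x x x]
  have h1 : character h x x = 1 := by simp [character]
  simp [h1]

theorem star_kernelFun (ω : ℝ) (a b : ℕ → ℝ) (s : ℕ) (x y : Cube s) :
    star (kernelFun ω a b s x y) = kernelFun ω a b s y x := by
  unfold kernelFun
  rw [tsum_star]
  refine tsum_congr fun h => ?_
  rw [star_mul', star_character]
  simp

/-- The kernel is positive semidefinite. -/
theorem posSemidef_kernelMatrix (ω : Set.Ioo (0 : ℝ) 1) (a b : ℕ → ℝ) (s : ℕ) :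
    (kernelMatrix ω a b s).PosSemidef := by
  have tfae := RKHS.posSemidef_tfae (K := kernelMatrix ω a b s)
  refine (tfae.out 0 2 rfl rfl).mpr ⟨?_, fun v => ?_⟩
  · ext x y
    simp only [kernelMatrix, Matrix.conjTranspose_apply, Matrix.of_apply, star_smul,
      star_kernelFun]
    rw [show ContinuousLinearMap.id ℂ ℂ = 1 from rfl, star_one]
  · by_cases hs : Summable fun h : Fin s → ℤ => weight ω a b h
    · have hsum : ∀ x y : Cube s,
          Summable fun h : Fin s → ℤ => (weight ω a b h : ℂ) * character h x y := by
        intro x y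
        refine Summable.of_norm ?_
        simpa [norm_character, abs_of_nonneg (weight_nonneg ω a b _)] using hs
      let z : Cube s := ⟨0, by simp⟩
      have key : (v.sum fun x w => v.sum fun x' w' =>
            inner ℂ (kernelMatrix ω a b s x' x w) w') =
          ∑' h : Fin s → ℤ, ((weight ω a b h *
            ‖∑ x ∈ v.support, character h x z * star (v x)‖ ^ 2 : ℝ) : ℂ) := by
        have hin : ∀ x x' : Cube s, inner ℂ (kernelMatrix ω a b s x' x (v x)) (v x') =
            ∑' h : Fin s → ℤ, ((weight ω a b h : ℂ) * character h x x') * (v x' * star (v x)) := by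
          intro x x'
          rw [tsum_mul_right]
          change inner ℂ (kernelFun ω a b s x' x • v x) (v x') = kernelFun ω a b s x x' * _
          rw [inner_smul_left, ← Complex.star_def, star_kernelFun]
          simp [mul_comm]
        simp only [Finsupp.sum, hin]
        rw [Finset.sum_congr rfl fun x _ => (Summable.tsum_finsetSum
          (fun x' _ => (hsum x x').mul_right _)).symm]
        rw [← Summable.tsum_finsetSum
          (fun x _ => summable_sum fun x' _ => (hsum x x').mul_right _)]
        refine tsum_congr fun h => ?_
        rw [Complex.ofReal_mul, Complex.ofReal_pow, ← Complex.mul_conj', map_sum,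
          Finset.sum_mul_sum, Finset.mul_sum]
        refine Finset.sum_congr rfl fun x _ => ?_
        rw [Finset.mul_sum]
        refine Finset.sum_congr rfl fun x' _ => ?_
        rw [character_eq h x x' z]
        simp
        ring
      rw [key, ← Complex.ofReal_tsum]
      exact tsum_nonneg fun h => mul_nonneg (weight_nonneg ω a b h) (by positivity)
    · have h0 : ∀ x y : Cube s, kernelFun ω a b s x y = 0 := by
        intro x y
        refine tsum_eq_zero_of_not_summable fun H => hs ?_
        simpa [norm_character, abs_of_nonneg (weight_nonneg ω a b _)] using H.norm
      simp [kernelMatrix, h0, Finsupp.sum]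

instance (ω : Set.Ioo (0 : ℝ) 1) (a b : ℕ → ℝ) (s : ℕ) :
    Fact (kernelMatrix ω a b s).PosSemidef :=
  ⟨posSemidef_kernelMatrix ω a b s⟩

/-- The Korobov space `H(K_{s,a,b})`: the reproducing kernel Hilbert space of complex-valued
functions on `[0,1]^s` with kernel `K_{s,a,b}`. -/
abbrev Space (ω : Set.Ioo (0 : ℝ) 1) (a b : ℕ → ℝ) (s : ℕ) : Type :=
  RKHS.OfKernel (kernelMatrix ω a b s)

/-- The information classes: all continuous linear functionals, or function values only. -/
inductive InfoClass
  | all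
  | std

/-- The absolute and the normalized error criterion. -/
inductive Criterion
  | abs
  | norm

/-- The continuous linear functional `L` belongs to the class `Λ`. -/
def InfoClass.Permits (Λ : InfoClass) {ω : Set.Ioo (0 : ℝ) 1} {a b : ℕ → ℝ} {s : ℕ}
    (L : Space ω a b s →L[ℂ] ℂ) : Prop :=
  match Λ with
  | .all => True
  | .std => ∃ x : Cube s, ∀ f : Space ω a b s, L f = f x

/-- A linear algorithm `A f = ∑_{k < n} L_k(f) α_k` with `α_k ∈ L_∞([0,1]^s)` that uses `n`
information evaluations from the class `Λ`. -/
structure Algorithm (Λ : InfoClass) (ω : Set.Ioo (0 : ℝ) 1) (a b : ℕ → ℝ) (n s : ℕ) where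
  α : Fin n → Cube s → ℂ
  memLp : ∀ k, MemLp (α k) ∞ (cubeMeasure s)
  L : Fin n → (Space ω a b s →L[ℂ] ℂ)
  permits : ∀ k, Λ.Permits (L k)

/-- The worst-case error of an algorithm: the supremum of the essential supremum norms
`‖f - A f‖_∞` over the unit ball of the Korobov space. -/
def Algorithm.error {Λ : InfoClass} {ω : Set.Ioo (0 : ℝ) 1} {a b : ℕ → ℝ} {n s : ℕ}
    (A : Algorithm Λ ω a b n s) : ℝ≥0∞ :=
  ⨆ (f : Space ω a b s) (_ : ‖f‖ ≤ 1),
    eLpNorm (fun x => f x - ∑ k, A.α k x * A.L k f) ∞ (cubeMeasure s)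

/-- The `n`th minimal worst-case error `e(n,s)`. For `n = 0` it is the initial error. -/
def minError (Λ : InfoClass) (ω : Set.Ioo (0 : ℝ) 1) (a b : ℕ → ℝ) (n s : ℕ) : ℝ≥0∞ :=
  ⨅ A : Algorithm Λ ω a b n s, A.error

/-- The factor multiplying `ε`: one for the absolute criterion, the initial error for the
normalized criterion. -/
def Criterion.scale (crit : Criterion) (Λ : InfoClass) (ω : Set.Ioo (0 : ℝ) 1) (a b : ℕ → ℝ)
    (s : ℕ) : ℝ≥0∞ :=
  match crit with
  | .abs => 1
  | .norm => minError Λ ω a b 0 s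

/-- The information complexity `n(ε,s)`: the least `n` with `e(n,s) ≤ ε` (absolute criterion) or
`e(n,s) ≤ ε e(0,s)` (normalized criterion). -/
def infoComplexity (Λ : InfoClass) (crit : Criterion) (ω : Set.Ioo (0 : ℝ) 1) (a b : ℕ → ℝ)
    (ε : ℝ) (s : ℕ) : ℕ :=
  sInf {n : ℕ | minError Λ ω a b n s ≤ ENNReal.ofReal ε * crit.scale Λ ω a b s}

/-- The function `p` is a rate of exponential convergence: there are `q ∈ (0,1)` and
`C, C₁ : {1,2,…} → (0,∞)` with `e(n,s) ≤ C(s) q ^ ((n / C₁(s)) ^ p(s))` for all `n, s ≥ 1`.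
Values at `s = 0` play no role. -/
def IsExpRate (Λ : InfoClass) (ω : Set.Ioo (0 : ℝ) 1) (a b : ℕ → ℝ) (p : ℕ → ℝ) : Prop :=
  (∀ s, 1 ≤ s → 0 < p s) ∧
    ∃ q ∈ Set.Ioo (0 : ℝ) 1, ∃ C C₁ : ℕ → ℝ, (∀ s, 1 ≤ s → 0 < C s ∧ 0 < C₁ s) ∧
      ∀ s, 1 ≤ s → ∀ n : ℕ, 1 ≤ n →
        minError Λ ω a b n s ≤ ENNReal.ofReal (C s * q ^ (((n : ℝ) / C₁ s) ^ p s))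

/-- Exponential convergence (EXP). -/
def EXP (Λ : InfoClass) (ω : Set.Ioo (0 : ℝ) 1) (a b : ℕ → ℝ) : Prop :=
  ∃ p : ℕ → ℝ, IsExpRate Λ ω a b p

/-- The values `p(s)` of all rates of exponential convergence; the supremum is `p*(s)`. -/
def expRates (Λ : InfoClass) (ω : Set.Ioo (0 : ℝ) 1) (a b : ℕ → ℝ) (s : ℕ) : Set ℝ :=
  {r | ∃ p : ℕ → ℝ, IsExpRate Λ ω a b p ∧ p s = r}

/-- The constant rates of exponential convergence; the supremum is `p*`. -/
def uniformExpRates (Λ : InfoClass) (ω : Set.Ioo (0 : ℝ) 1) (a b : ℕ → ℝ) : Set ℝ :=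
  {r | IsExpRate Λ ω a b fun _ => r}

/-- Uniform exponential convergence (UEXP). -/
def UEXP (Λ : InfoClass) (ω : Set.Ioo (0 : ℝ) 1) (a b : ℕ → ℝ) : Prop :=
  ∃ r : ℝ, IsExpRate Λ ω a b fun _ => r

/-- The limit `s + log ε⁻¹ → ∞` over `s ∈ {1,2,…}` and `ε ∈ (0,1)`. -/
def ecFilter : Filter (ℕ × ℝ) :=
  comap (fun t : ℕ × ℝ => (t.1 : ℝ) + Real.log t.2⁻¹) atTop ⊓
    𝓟 {t | 1 ≤ t.1 ∧ t.2 ∈ Set.Ioo (0 : ℝ) 1}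

/-- `κ`-EC-weak tractability. -/
def KappaECWT (Λ : InfoClass) (crit : Criterion) (ω : Set.Ioo (0 : ℝ) 1) (a b : ℕ → ℝ)
    (κ : ℝ) : Prop :=
  Tendsto (fun t : ℕ × ℝ => Real.log (infoComplexity Λ crit ω a b t.2 t.1 : ℝ) /
    ((t.1 : ℝ) + Real.log t.2⁻¹ ^ κ)) ecFilter (𝓝 0)

/-- EC-weak tractability. -/
def ECWT (Λ : InfoClass) (crit : Criterion) (ω : Set.Ioo (0 : ℝ) 1) (a b : ℕ → ℝ) : Prop :=
  KappaECWT Λ crit ω a b 1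

/-- EC-polynomial tractability. -/
def ECPT (Λ : InfoClass) (crit : Criterion) (ω : Set.Ioo (0 : ℝ) 1) (a b : ℕ → ℝ) : Prop :=
  ∃ c τ₁ τ₂ : ℝ, 0 ≤ c ∧ 0 ≤ τ₁ ∧ 0 ≤ τ₂ ∧
    ∀ s : ℕ, 1 ≤ s → ∀ ε ∈ Set.Ioo (0 : ℝ) 1,
      (infoComplexity Λ crit ω a b ε s : ℝ) ≤ c * (s : ℝ) ^ τ₁ * (1 + Real.log ε⁻¹) ^ τ₂

/-- The exponents `τ ≥ 0` for which the bound of EC-strong polynomial tractability holds. -/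
def sptExponents (Λ : InfoClass) (crit : Criterion) (ω : Set.Ioo (0 : ℝ) 1) (a b : ℕ → ℝ) :
    Set ℝ :=
  {τ | 0 ≤ τ ∧ ∃ c : ℝ, 0 ≤ c ∧ ∀ s : ℕ, 1 ≤ s → ∀ ε ∈ Set.Ioo (0 : ℝ) 1,
    (infoComplexity Λ crit ω a b ε s : ℝ) ≤ c * (1 + Real.log ε⁻¹) ^ τ}

/-- EC-strong polynomial tractability. -/
def ECSPT (Λ : InfoClass) (crit : Criterion) (ω : Set.Ioo (0 : ℝ) 1) (a b : ℕ → ℝ) : Prop :=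
  (sptExponents Λ crit ω a b).Nonempty

/-- The exponent `τ*` of EC-strong polynomial tractability. -/
def tauStar (Λ : InfoClass) (crit : Criterion) (ω : Set.Ioo (0 : ℝ) 1) (a b : ℕ → ℝ) : ℝ :=
  sInf (sptExponents Λ crit ω a b)

/-- `α* = liminf_{j → ∞} (log a_j) / j`, possibly infinite. -/
def alphaStar (a : ℕ → ℝ) : EReal :=
  liminf (fun j : ℕ => ((Real.log (a j) / ((j : ℝ) + 1) : ℝ) : EReal)) atTop

end Korobov

end

/-!
The Korobov space is isometric to `ℓ²(ℤ^s)` through the Fourier coefficients in the orthonormal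
basis `√ω_h exp (2 π i h · x)` (`exists_coefficients`). All averages over the cube are taken over
rank-one lattices that separate a finite set of frequencies, on which the exponentials are exactly
orthogonal up to aliasing (`sum_star_wave_mul_wave_node`); no Fourier integrals are needed.

Write `L = log ω⁻¹`, so that `ω_h = exp (-L E(h))` with `E(h) = ∑ a_j |h_j| ^ b_j`.

*Upper bounds, for function values.* Interpolation on a lattice that separates `F` has squared
error at most `4 ∑_{h ∉ F} ω_h` (`minError_le_of_separates`). If `F` contains all frequencies with
`E(h) ≤ T`, this tail is at most `exp (-L T / 2) ∑ ω_h ^ (1 / 2)`, and the last sum is at most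
`exp (D ∑_{j < s} exp (-L a_j / 2))`. Two choices of lattice are used. Boxes with sides
`2 ⌊(T / a_j) ^ (1 / b_j)⌋ + 1` are separated by a mixed radix lattice with as many points as the
box has frequencies (`exists_separates_box`); this is sharp enough for the rate `1 / B(s)` and,
since only about `log T / α*` sides exceed one, for the exponent `B + log 3 / α*`. For weak tractability
boxes are too large, and the `N` frequencies with `E(h) ≤ T` are separated by a lattice with a
prime number of points polynomial in `N`, `s` and `T` (`exists_separates_prime`). If `a_j → ∞`, then
`N = exp (o(s + T))`.

*Lower bounds, for arbitrary functionals.* Functions in the kernel of `n` functionals are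
approximated by zero. Hence for each finite `F` the squared error is at least `∑_{h ∈ F} ω_h p_h`
with `0 ≤ p_h ≤ 1` and `∑ p_h ≥ |F| - n` (`exists_compression_of_error_le`). This gives both the
bound by the `(n+1)`st largest weight (`sqrt_le_minError`) and the trace bound `∑ ω_h - n`
(`sum_weight_le_of_minError_le`). Counting frequencies in boxes, respectively in `{0, 1}^s`, turns
the first into `p*(s) ≤ 1 / B(s)`, `τ* ≥ B` and `α* > 0`; for bounded `a` the second makes the
complexity exponential in `s`, under the normalized criterion as well.
-/

noncomputable section

namespace Korobov

/-! ### Exponentials and lattice points -/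

/-- The exponential `x ↦ exp (2 π i h · x)` on the cube. -/
def wave {s : ℕ} (h : Fin s → ℤ) (x : Cube s) : ℂ :=
  Complex.exp (2 * Real.pi * Complex.I * ∑ j : Fin s, (h j : ℂ) * (x.1 j : ℂ))

theorem character_eq_wave {s : ℕ} (h : Fin s → ℤ) (x y : Cube s) :
    character h x y = wave h x * star (wave h y) := by
  let z : Cube s := ⟨0, by simp⟩
  have hz : ∀ u : Cube s, character h u z = wave h u := fun u => by simp [character, wave, z]
  rw [character_eq h x y z, hz, hz]

theorem norm_wave {s : ℕ} (h : Fin s → ℤ) (x : Cube s) : ‖wave h x‖ = 1 := by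
  have h1 := norm_character h x x
  rw [character_eq_wave, norm_mul, norm_star] at h1
  nlinarith [norm_nonneg (wave h x)]

theorem continuous_wave {s : ℕ} (h : Fin s → ℤ) : Continuous (wave h) := by
  have : ∀ j : Fin s, Continuous fun x : Cube s => ((x.1 j : ℝ) : ℂ) := fun j =>
    Complex.continuous_ofReal.comp ((continuous_apply j).comp continuous_subtype_val)
  exact Complex.continuous_exp.comp
    (continuous_const.mul (continuous_finsetSum _ fun j _ => continuous_const.mul (this j)))

/-- The `k`th point of the rank-one lattice with `P` points and generating vector `g`, that is, the
reduction of `k g / P` modulo one. -/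
def node {s : ℕ} (P : ℕ) (g : Fin s → ℤ) (k : ℕ) : Cube s :=
  ⟨fun j => Int.fract ((k : ℝ) * g j / P),
    fun _ => Int.fract_nonneg _, fun _ => (Int.fract_lt_one _).le⟩

theorem wave_node {s : ℕ} (P : ℕ) (g h : Fin s → ℤ) (k : ℕ) :
    wave h (node P g k) =
      Complex.exp (2 * Real.pi * Complex.I * ((h ⬝ᵥ g : ℤ) : ℂ) / P) ^ k := by
  rw [← Complex.exp_nat_mul, wave]
  refine Complex.exp_eq_exp_iff_exists_int.mpr
    ⟨-∑ j, h j * ⌊(k : ℝ) * g j / P⌋, ?_⟩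
  have : ∀ j, (((node P g k).1 j : ℝ) : ℂ) =
      (k : ℂ) * g j / P - (⌊(k : ℝ) * g j / P⌋ : ℂ) := by
    intro j
    change ((Int.fract ((k : ℝ) * g j / P) : ℝ) : ℂ) = _
    rw [Int.fract]
    push_cast
    rfl
  simp only [this, dotProduct]
  push_cast
  simp only [mul_sub, Finset.sum_sub_distrib]
  have e : ∑ x, (h x : ℂ) * ((k : ℂ) * g x / P) = k * (∑ x, (h x : ℂ) * g x) / P := by
    rw [Finset.mul_sum, Finset.sum_div]
    exact Finset.sum_congr rfl fun _ _ => by ring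
  rw [e]
  ring

/-- Orthogonality of exponentials on a rank-one lattice, up to aliasing. -/
theorem sum_star_wave_mul_wave_node {s : ℕ} {P : ℕ} (hP : 0 < P) (g h l : Fin s → ℤ) :
    ∑ k : Fin P, star (wave h (node P g k)) * wave l (node P g k) =
      if (P : ℤ) ∣ (l - h) ⬝ᵥ g then (P : ℂ) else 0 := by
  have hP0 : (P : ℂ) ≠ 0 := by exact_mod_cast hP.ne'
  set ζ : ℂ := Complex.exp (2 * Real.pi * Complex.I * (((l - h) ⬝ᵥ g : ℤ) : ℂ) / P) with hζ
  have hterm : ∀ k : ℕ, star (wave h (node P g k)) * wave l (node P g k) = ζ ^ k := by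
    intro k
    rw [wave_node, wave_node, star_pow, ← mul_pow, Complex.star_def, ← Complex.exp_conj,
      ← Complex.exp_add, hζ]
    congr 2
    simp only [map_mul, map_div₀, Complex.conj_I, Complex.conj_ofReal, map_ofNat, map_intCast,
      map_natCast, sub_dotProduct]
    push_cast
    ring
  rw [Finset.sum_congr rfl fun (k : Fin P) _ => hterm k, Fin.sum_univ_eq_sum_range fun k => ζ ^ k]
  have hone : ζ = 1 ↔ (P : ℤ) ∣ (l - h) ⬝ᵥ g := by
    rw [hζ, Complex.exp_eq_one_iff]
    have h2 : (2 * Real.pi * Complex.I : ℂ) ≠ 0 := by simp [Real.pi_ne_zero]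
    constructor
    · rintro ⟨n, hn⟩
      refine ⟨n, ?_⟩
      rw [div_eq_iff hP0] at hn
      have : (2 * Real.pi * Complex.I : ℂ) * (((l - h) ⬝ᵥ g : ℤ) : ℂ) =
          (2 * Real.pi * Complex.I : ℂ) * ((P : ℂ) * n) := by rw [hn]; ring
      have := mul_left_cancel₀ h2 this
      exact_mod_cast this
    · rintro ⟨n, hn⟩
      refine ⟨n, ?_⟩
      rw [hn]
      push_cast
      field_simp
  split_ifs with hd
  · rw [hone.mpr hd]
    simp
  · have hne : ζ ≠ 1 := fun e => hd (hone.mp e)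
    rw [geom_sum_eq hne]
    have : ζ ^ P = 1 := by
      rw [hζ, ← Complex.exp_nat_mul, Complex.exp_eq_one_iff]
      exact ⟨(l - h) ⬝ᵥ g, by field_simp⟩
    simp [this]

/-- The rank-one lattice with `P` points and generating vector `g` does not alias any two
frequencies of `F`. -/
def Separates {s : ℕ} (P : ℕ) (g : Fin s → ℤ) (F : Finset (Fin s → ℤ)) : Prop :=
  ∀ h ∈ F, ∀ l ∈ F, (P : ℤ) ∣ (l - h) ⬝ᵥ g → h = l

/-- The generating vector `(1, m₀, m₀ m₁, …)`: frequencies of a box with side lengths `m j` become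
the digits of a mixed radix expansion. -/
theorem exists_mixedRadix : ∀ {s : ℕ} (m : Fin s → ℕ), (∀ j, 0 < m j) →
    ∃ g : Fin s → ℤ, ∀ d : Fin s → ℤ, (∀ j, |d j| < m j) →
      ((∏ j, m j : ℕ) : ℤ) ∣ d ⬝ᵥ g → d = 0 := by
  intro s
  induction s with
  | zero => exact fun m _ => ⟨0, fun d _ _ => Subsingleton.elim _ _⟩
  | succ s ih =>
    intro m hm
    obtain ⟨g, hg⟩ := ih (fun j => m j.succ) fun j => hm _
    refine ⟨Fin.cons 1 fun j => m 0 * g j, fun d hd hdvd => ?_⟩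
    have hsum : d ⬝ᵥ (Fin.cons 1 fun j => (m 0 : ℤ) * g j : Fin (s + 1) → ℤ) =
        d 0 + m 0 * ((fun j => d (Fin.succ j)) ⬝ᵥ g) := by
      simp only [dotProduct, Fin.sum_univ_succ, Fin.cons_zero, Fin.cons_succ, mul_one,
        Finset.mul_sum]
      congr 1
      exact Finset.sum_congr rfl fun _ _ => by ring
    rw [hsum, Fin.prod_univ_succ, Nat.cast_mul] at hdvd
    have h0 : d 0 = 0 := by
      refine Int.eq_zero_of_abs_lt_dvd ?_ (hd 0)
      exact (Int.dvd_add_left (dvd_mul_right _ _)).mp ((dvd_mul_right _ _).trans hdvd)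
    rw [h0, zero_add] at hdvd
    have hm0 : (m 0 : ℤ) ≠ 0 := by exact_mod_cast (hm 0).ne'
    have h1 := hg (fun j => d j.succ) (fun j => hd _) ((mul_dvd_mul_iff_left hm0).mp hdvd)
    funext j
    refine Fin.cases h0 (fun i => congrFun h1 i) j

theorem exists_separates_box {s : ℕ} (k : Fin s → ℕ) (F : Finset (Fin s → ℤ))
    (hF : ∀ h ∈ F, ∀ j, |h j| ≤ k j) :
    ∃ g : Fin s → ℤ, Separates (∏ j, (2 * k j + 1)) g F := by
  obtain ⟨g, hg⟩ := exists_mixedRadix (fun j => 2 * k j + 1) fun j => by omega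
  refine ⟨g, fun h hh l hl hd => ?_⟩
  have := hg (l - h) (fun j => ?_) hd
  · exact (sub_eq_zero.mp this).symm
  · have h1 := abs_le.mp (hF h hh j)
    have h2 := abs_le.mp (hF l hl j)
    simp only [Pi.sub_apply]
    rw [abs_lt]
    push_cast
    constructor <;> omega

/-- Every finite set of frequencies is separated by some lattice. -/
theorem exists_separates {s : ℕ} (F : Finset (Fin s → ℤ)) :
    ∃ P : ℕ, 0 < P ∧ ∃ g : Fin s → ℤ, Separates P g F := by
  obtain ⟨g, hg⟩ := exists_separates_box (fun j => F.sup fun h => (h j).natAbs) F fun h hh j => by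
    rw [Int.abs_eq_natAbs]
    exact_mod_cast Finset.le_sup (f := fun h : Fin s → ℤ => (h j).natAbs) hh
  exact ⟨_, Finset.prod_pos fun j _ => by omega, g, hg⟩

open Polynomial in
/-- A prime number of points exceeding `s |F|²` and the differences of the components suffices, with
a generating vector of Korobov form `(1, g, g², …)`: each pair of frequencies rules out the at most
`s` roots of a polynomial over `ZMod P`. -/
theorem exists_separates_prime {s : ℕ} (F : Finset (Fin s → ℤ)) {P : ℕ} (hP : P.Prime)
    (hcard : F.card * F.card * s < P) (hF : ∀ h ∈ F, ∀ j, 2 * |h j| < P) :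
    ∃ g : Fin s → ℤ, Separates P g F := by
  classical
  have : Fact P.Prime := ⟨hP⟩
  let poly : (Fin s → ℤ) → (ZMod P)[X] := fun d => ∑ j : Fin s, C (d j : ZMod P) * X ^ (j : ℕ)
  have hcoeff : ∀ d (j : Fin s), (poly d).coeff j = (d j : ZMod P) := by
    intro d j
    simp only [poly, finsetSum_coeff, coeff_C_mul, coeff_X_pow]
    rw [Finset.sum_eq_single j]
    · simp
    · intro i _ hij
      have : ((j : ℕ) = (i : ℕ)) ↔ False := by simp [Fin.val_inj, hij.symm]
      simp [this]
    · simp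
  have hdeg : ∀ d, (poly d).roots.toFinset.card ≤ s := by
    intro d
    refine (Multiset.toFinset_card_le _).trans ((card_roots' _).trans ?_)
    refine natDegree_sum_le_of_forall_le _ _ fun j _ => ?_
    exact (natDegree_C_mul_X_pow_le _ _).trans j.2.le
  let bad : Finset (ZMod P) := (F ×ˢ F).biUnion fun p => (poly (p.2 - p.1)).roots.toFinset
  have hbad : bad.card < (Finset.univ : Finset (ZMod P)).card := by
    rw [Finset.card_univ, ZMod.card]
    refine lt_of_le_of_lt ?_ hcard
    refine (Finset.card_biUnion_le_card_mul _ _ s fun p _ => hdeg _).trans ?_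
    rw [Finset.card_product]
  obtain ⟨x, -, hx⟩ := Finset.exists_mem_notMem_of_card_lt_card hbad
  refine ⟨fun j => (x.val : ℤ) ^ (j : ℕ), fun h hh l hl hd => ?_⟩
  by_contra hne
  have hpoly : poly (l - h) ≠ 0 := by
    obtain ⟨j, hj⟩ := Function.ne_iff.mp hne
    intro h0
    have h1 := hcoeff (l - h) j
    rw [h0, coeff_zero] at h1
    have h2 := (ZMod.intCast_zmod_eq_zero_iff_dvd _ _).mp h1.symm
    have h3 : (l - h) j = 0 := by
      refine Int.eq_zero_of_abs_lt_dvd h2 ?_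
      have := hF h hh j
      have := hF l hl j
      have := abs_sub (l j) (h j)
      simp only [Pi.sub_apply]
      omega
    exact hj (sub_eq_zero.mp h3).symm
  refine hx (Finset.mem_biUnion.mpr ⟨(h, l), Finset.mk_mem_product hh hl, ?_⟩)
  rw [Multiset.mem_toFinset, mem_roots hpoly, IsRoot.def]
  have h2 := (ZMod.intCast_zmod_eq_zero_iff_dvd _ _).mpr hd
  rw [← h2]
  simp [poly, eval_finsetSum, dotProduct]

/-! ### Fourier description of the Korobov space -/

variable {ω : Set.Ioo (0 : ℝ) 1} {a b : ℕ → ℝ} {s : ℕ}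

theorem norm_sqrt_mul_wave (t : ℝ) (h : Fin s → ℤ) (x : Cube s) :
    ‖(√t : ℂ) * star (wave h x)‖ = √t := by
  rw [norm_mul, norm_star, norm_wave, mul_one, Complex.norm_real, Real.norm_eq_abs,
    abs_of_nonneg (Real.sqrt_nonneg _)]

/-- The square-summable coefficient family of the kernel function at `x`. -/
def feature (hS : Summable fun h : Fin s → ℤ => weight ω a b h) (x : Cube s) :
    lp (fun _ : Fin s → ℤ => ℂ) 2 :=
  ⟨fun h => (√(weight ω a b h) : ℂ) * star (wave h x), by
    refine memℓp_gen ?_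
    refine hS.congr fun h => ?_
    rw [norm_sqrt_mul_wave]
    simp [Real.sq_sqrt (weight_nonneg ω a b h)]⟩

theorem hasSum_inner_feature (hS : Summable fun h : Fin s → ℤ => weight ω a b h) (x : Cube s)
    (v : lp (fun _ : Fin s → ℤ => ℂ) 2) :
    HasSum (fun h => (√(weight ω a b h) : ℂ) * v h * wave h x) (inner ℂ (feature hS x) v) := by
  refine (lp.hasSum_inner (𝕜 := ℂ) (feature hS x) v).congr_fun fun h => ?_
  change _ = v h * star ((√(weight ω a b h) : ℂ) * star (wave h x))
  simp
  ring

theorem summable_sqrt_weight_mul (hS : Summable fun h : Fin s → ℤ => weight ω a b h)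
    (v : lp (fun _ : Fin s → ℤ => ℂ) 2) :
    Summable fun h => ‖(√(weight ω a b h) : ℂ) * v h‖ := by
  let x : Cube s := ⟨0, by simp⟩
  refine (hasSum_inner_feature hS x v).summable.norm.congr fun h => ?_
  rw [norm_mul _ (wave h x), norm_wave, mul_one]

/-- An absolutely convergent trigonometric series that vanishes everywhere has zero coefficients:
averaging against `wave h` over a lattice that separates a finite set `F` leaves the coefficient of
`h` and terms with index outside `F`. -/
theorem eq_zero_of_hasSum_wave {c : (Fin s → ℤ) → ℂ} (hc : Summable fun h => ‖c h‖)
    (h0 : ∀ x, HasSum (fun h => c h * wave h x) 0) : c = 0 := by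
  classical
  funext h
  have key : ∀ F : Finset (Fin s → ℤ), h ∈ F → ‖c h‖ ≤ ∑' l : {l // l ∉ F}, ‖c l‖ := by
    intro F hF
    obtain ⟨P, hP, g, hg⟩ := exists_separates F
    have hP0 : (P : ℂ) ≠ 0 := by exact_mod_cast hP.ne'
    have h1 : HasSum (fun l => ∑ k : Fin P, star (wave h (node P g k)) *
        (c l * wave l (node P g k))) 0 := by
      simpa using hasSum_sum (s := Finset.univ) fun (k : Fin P) _ =>
        (h0 (node P g k)).mul_left (star (wave h (node P g k)))
    have h2 : HasSum (fun l => if (P : ℤ) ∣ (l - h) ⬝ᵥ g then c l else 0) 0 := by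
      have := h1.div_const (P : ℂ)
      rw [zero_div] at this
      refine this.congr_fun fun l => ?_
      have e : ∑ k : Fin P, star (wave h (node P g k)) * (c l * wave l (node P g k)) =
          c l * ∑ k : Fin P, star (wave h (node P g k)) * wave l (node P g k) := by
        rw [Finset.mul_sum]
        exact Finset.sum_congr rfl fun _ _ => by ring
      rw [e, sum_star_wave_mul_wave_node hP]
      split_ifs <;> simp [hP0]
    have h3 := h2.update h 0
    have h4 : ‖c h‖ = ‖∑' l, if (P : ℤ) ∣ (l - h) ⬝ᵥ g ∧ l ≠ h then c l else 0‖ := by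
      have e : ∀ l, (if (P : ℤ) ∣ (l - h) ⬝ᵥ g ∧ l ≠ h then c l else 0) =
          Function.update (fun l => if (P : ℤ) ∣ (l - h) ⬝ᵥ g then c l else 0) h 0 l := by
        intro l
        by_cases hl : l = h
        · subst hl; simp
        · simp [hl]
      rw [tsum_congr e, h3.tsum_eq]
      simp
    rw [h4, ← Function.Injective.tsum_eq (g := ((↑) : {l // l ∉ F} → (Fin s → ℤ)))
      Subtype.val_injective]
    · refine (norm_tsum_le_tsum_norm ?_).trans (Summable.tsum_le_tsum ?_ ?_ ?_)
      · refine (hc.subtype {l | l ∉ F}).of_nonneg_of_le (fun _ => norm_nonneg _) fun l => ?_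
        split_ifs <;> simp
      · intro l
        split_ifs <;> simp
      · refine (hc.subtype {l | l ∉ F}).of_nonneg_of_le (fun _ => norm_nonneg _) fun l => ?_
        split_ifs <;> simp
      · exact hc.subtype {l | l ∉ F}
    · intro l hl
      rw [Function.mem_support, ne_eq, ite_eq_right_iff, not_forall] at hl
      obtain ⟨⟨hd, hne⟩, -⟩ := hl
      simp only [Subtype.range_coe_subtype, Set.mem_ofPred_eq]
      exact fun hlF => hne (hg h hF l hlF hd).symm
  have hlim := tendsto_tsum_compl_atTop_zero fun l => ‖c l‖
  have := ge_of_tendsto hlim ((eventually_ge_atTop {h}).mono fun F hF =>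
    key F (Finset.singleton_subset_iff.mp hF))
  exact norm_eq_zero.mp (le_antisymm this (norm_nonneg _))

theorem kerFun_apply_eq (x y : Cube s) :
    RKHS.kerFun (Space ω a b s) y (1 : ℂ) x = kernelFun ω a b s x y := by
  rw [RKHS.kerFun_apply, RKHS.OfKernel.kernel_ofKernel]
  simp [kernelMatrix]

theorem inner_kerFun_eq (f : Space ω a b s) (x : Cube s) :
    inner ℂ (RKHS.kerFun (Space ω a b s) x (1 : ℂ)) f = f x := by
  rw [RKHS.kerFun_inner]
  simp

theorem inner_feature_eq (hS : Summable fun h : Fin s → ℤ => weight ω a b h) (x y : Cube s) :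
    inner ℂ (feature hS x) (feature hS y) = kernelFun ω a b s x y := by
  rw [← (hasSum_inner_feature hS x (feature hS y)).tsum_eq, kernelFun]
  refine tsum_congr fun h => ?_
  change (√(weight ω a b h) : ℂ) * ((√(weight ω a b h) : ℂ) * star (wave h y)) * wave h x = _
  rw [character_eq_wave]
  have : (√(weight ω a b h) : ℂ) * (√(weight ω a b h) : ℂ) = weight ω a b h := by
    rw [← Complex.ofReal_mul, Real.mul_self_sqrt (weight_nonneg ω a b h)]
  linear_combination (wave h x * star (wave h y)) * this

theorem denseRange_kerFun :
    DenseRange (Finsupp.linearCombination ℂ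
      fun x : Cube s => RKHS.kerFun (Space ω a b s) x (1 : ℂ)) := by
  have h1 := RKHS.kerFun_dense (Space ω a b s)
  have h2 : Submodule.span ℂ {RKHS.kerFun (Space ω a b s) x v | (x) (v)} ≤
      LinearMap.range (Finsupp.linearCombination ℂ
        fun x : Cube s => RKHS.kerFun (Space ω a b s) x (1 : ℂ)) := by
    rw [Submodule.span_le]
    rintro _ ⟨x, v, rfl⟩
    refine ⟨Finsupp.single x v, ?_⟩
    rw [Finsupp.linearCombination_single, ← map_smul]
    simp
  rw [DenseRange, ← LinearMap.coe_range, Submodule.dense_iff_topologicalClosure_eq_top, eq_top_iff,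
    ← h1]
  exact Submodule.topologicalClosure_mono h2

theorem denseRange_feature (hω : ∀ h : Fin s → ℤ, 0 < weight ω a b h)
    (hS : Summable fun h : Fin s → ℤ => weight ω a b h) :
    DenseRange (Finsupp.linearCombination ℂ (feature hS)) := by
  rw [DenseRange, ← LinearMap.coe_range, Submodule.dense_iff_topologicalClosure_eq_top,
    Submodule.topologicalClosure_eq_top_iff, Submodule.eq_bot_iff]
  intro v hv
  have h0 : ∀ x, inner ℂ (feature hS x) v = 0 := fun x =>
    
    Submodule.inner_right_of_mem_orthogonal (LinearMap.mem_range.mpr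
      ⟨Finsupp.single x 1, by simp⟩) hv
  have h1 := eq_zero_of_hasSum_wave (summable_sqrt_weight_mul hS v) fun x => by
    simpa only [h0 x] using hasSum_inner_feature hS x v
  ext h
  have h2 := congrFun h1 h
  have h3 : (√(weight ω a b h) : ℂ) ≠ 0 := by
    exact_mod_cast (Real.sqrt_pos.mpr (hω h)).ne'
  simpa [h3] using h2

/-- The Korobov space is isometric to `ℓ²(ℤ^s)`, by the coefficients in the orthonormal basis of
functions `√ω_h exp (2 π i h · x)`. -/
theorem exists_coefficients (hω : ∀ h : Fin s → ℤ, 0 < weight ω a b h)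
    (hS : Summable fun h : Fin s → ℤ => weight ω a b h) :
    ∃ J : Space ω a b s ≃ₗᵢ[ℂ] lp (fun _ : Fin s → ℤ => ℂ) 2, ∀ f x,
      f x = inner ℂ (feature hS x) (J f) := by
  have hnorm : ∀ u : Cube s →₀ ℂ,
      ‖Finsupp.linearCombination ℂ (feature hS) (LinearEquiv.refl ℂ (Cube s →₀ ℂ) u)‖ =
      ‖Finsupp.linearCombination ℂ
        (fun x : Cube s => RKHS.kerFun (Space ω a b s) x (1 : ℂ)) u‖ := by
    intro u
    rw [@norm_eq_sqrt_re_inner ℂ, @norm_eq_sqrt_re_inner ℂ]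
    congr 2
    simp only [LinearEquiv.refl_apply, Finsupp.linearCombination_apply, Finsupp.sum_inner,
      Finsupp.inner_sum, inner_feature_eq, inner_kerFun_eq, kerFun_apply_eq, inner_smul_right,
      inner_smul_left]
  let J := (LinearEquiv.refl ℂ (Cube s →₀ ℂ)).extendOfIsometry _ _
    denseRange_kerFun (denseRange_feature hω hS) hnorm
  have hJ : ∀ x, J (RKHS.kerFun (Space ω a b s) x (1 : ℂ)) = feature hS x := by
    intro x
    have := LinearEquiv.extendOfIsometry_eq (LinearEquiv.refl ℂ (Cube s →₀ ℂ))
      _ _ denseRange_kerFun (denseRange_feature hω hS) hnorm (Finsupp.single x 1)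
    simpa using this
  refine ⟨J, fun f x => ?_⟩
  rw [← inner_kerFun_eq f x, ← J.inner_map_map, hJ]

/-! ### Continuous functions on the cube -/

instance isOpenPosMeasure_cubeMeasure (s : ℕ) : (cubeMeasure s).IsOpenPosMeasure where
  open_pos U hU hne := by
    obtain ⟨V, hV, rfl⟩ := isOpen_induced_iff.mp hU
    obtain ⟨x, hx⟩ := hne
    set O : Set (Fin s → ℝ) := Set.pi Set.univ fun _ => Set.Ioo 0 1 with hO
    have hOo : IsOpen O := isOpen_set_pi Set.finite_univ fun _ _ => isOpen_Ioo
    have hcl : x.1 ∈ closure O := by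
      rw [hO, closure_pi_set]
      intro j _
      rw [closure_Ioo zero_ne_one]
      exact ⟨x.2.1 j, x.2.2 j⟩
    have hne' : (V ∩ O).Nonempty := mem_closure_iff.mp hcl V hV hx
    have hpos : 0 < (volume : Measure (Fin s → ℝ)) (V ∩ O) := (hV.inter hOo).measure_pos _ hne'
    rw [cubeMeasure, comap_subtype_coe_apply measurableSet_Icc, Subtype.image_preimage_coe]
    refine (hpos.trans_le (measure_mono ?_)).ne'
    rintro y ⟨hyV, hyO⟩
    exact ⟨⟨fun j => (hyO j trivial).1.le, fun j => (hyO j trivial).2.le⟩, hyV⟩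

/-- A continuous function on the cube is bounded everywhere by its essential supremum. -/
theorem norm_le_of_eLpNorm_le {f : Cube s → ℂ} (hf : Continuous f) {E : ℝ} (hE : 0 ≤ E)
    (h : eLpNorm f ∞ (cubeMeasure s) ≤ ENNReal.ofReal E) (x : Cube s) : ‖f x‖ ≤ E := by
  have hae : ∀ᵐ y ∂cubeMeasure s, ‖f y‖ ≤ E := by
    rw [eLpNorm_exponent_top] at h
    filter_upwards [ae_le_eLpNormEssSup (f := f) (μ := cubeMeasure s)] with y hy
    have := hy.trans h
    rwa [← ofReal_norm, ENNReal.ofReal_le_ofReal_iff hE] at this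
  have hd := Measure.dense_of_ae hae
  have hc : IsClosed {y | ‖f y‖ ≤ E} := isClosed_le hf.norm continuous_const
  have := hd.closure_eq
  rw [hc.closure_eq] at this
  exact Set.eq_univ_iff_forall.mp this x

/-! ### Lower bounds for the minimal errors -/

/-- Let the coordinates of the vectors `φ k` be orthogonal as functions of `k`, with mean squares
`w`. If every unit vector in the kernel of `n` linear functionals has inner products at most `E` with
all `φ k`, then the compression of the diagonal matrix `w` to this kernel has trace at most `E²`.
The numbers `p i` are the squared norms of the projections of the coordinate vectors onto the kernel,
and their sum is its dimension. -/
theorem exists_compression {ι : Type*} [Fintype ι] [DecidableEq ι] {n P : ℕ} (hP : 0 < P)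
    (M : EuclideanSpace ℂ ι →ₗ[ℂ] (Fin n → ℂ)) (φ : Fin P → EuclideanSpace ℂ ι) (w : ι → ℝ)
    (horth : ∀ i j, ∑ k, star (φ k i) * φ k j = if i = j then (P : ℂ) * w i else 0) {E : ℝ}
    (hE : ∀ c, M c = 0 → ‖c‖ ≤ 1 → ∀ k, ‖inner ℂ (φ k) c‖ ≤ E) :
    ∃ p : ι → ℝ, (∀ i, 0 ≤ p i ∧ p i ≤ 1) ∧ (Fintype.card ι : ℝ) - n ≤ ∑ i, p i ∧
      ∑ i, w i * p i ≤ E ^ 2 := by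
  set U := LinearMap.ker M with hU
  let B := EuclideanSpace.basisFun ι ℂ
  have hidem : ∀ v, inner ℂ v (U.starProjection v) = ((‖U.starProjection v‖ ^ 2 : ℝ) : ℂ) := by
    intro v
    have h1 : U.starProjection (U.starProjection v) = U.starProjection v :=
      U.starProjection_eq_self_iff.mpr (U.starProjection_apply_mem v)
    rw [← h1, ← U.inner_starProjection_left_eq_right, h1, inner_self_eq_norm_sq_to_K]
    simp
  refine ⟨fun i => ‖U.starProjection (B i)‖ ^ 2, fun i => ⟨by positivity, ?_⟩, ?_, ?_⟩
  · have h1 : ‖U.starProjection (B i)‖ ≤ ‖B i‖ := U.norm_starProjection_apply_le (B i)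
    rw [B.orthonormal.1 i] at h1
    exact pow_le_one₀ (norm_nonneg _) h1
  · have h1 := LinearMap.trace_eq_sum_inner (U.starProjection : _ →ₗ[ℂ] EuclideanSpace ℂ ι) B
    have h2 : LinearMap.IsProj U (U.starProjection : _ →ₗ[ℂ] EuclideanSpace ℂ ι) :=
      ⟨fun x => U.starProjection_apply_mem x, fun x hx => U.starProjection_eq_self_iff.mpr hx⟩
    rw [h2.trace] at h1
    have h3 : (Module.finrank ℂ U : ℝ) = ∑ i, ‖U.starProjection (B i)‖ ^ 2 := by
      have h4 : ((Module.finrank ℂ U : ℝ) : ℂ) =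
          ((∑ i, ‖U.starProjection (B i)‖ ^ 2 : ℝ) : ℂ) := by
        push_cast
        rw [h1]
        refine Finset.sum_congr rfl fun i _ => ?_
        rw [ContinuousLinearMap.coe_coe, hidem]
        push_cast
        rfl
      exact_mod_cast h4
    rw [← h3]
    have h5 := LinearMap.finrank_range_add_finrank_ker M
    have h6 : Module.finrank ℂ (LinearMap.range M) ≤ n :=
      (Submodule.finrank_le _).trans (by simp)
    rw [finrank_euclideanSpace, ← hU] at h5
    have h7 : Fintype.card ι ≤ n + Module.finrank ℂ U := by omega
    have h8 : (Fintype.card ι : ℝ) ≤ n + Module.finrank ℂ U := by exact_mod_cast h7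
    linarith
  · have hk : ∀ k, ‖U.starProjection (φ k)‖ ^ 2 ≤ E ^ 2 := by
      intro k
      set u := U.starProjection (φ k) with hu
      rcases eq_or_ne u 0 with h0 | h0
      · rw [h0]
        simp [sq_nonneg]
      · have hn : 0 < ‖u‖ := norm_pos_iff.mpr h0
        have h1 := hE ((‖u‖⁻¹ : ℂ) • u)
          (by rw [map_smul, LinearMap.mem_ker.mp (U.starProjection_apply_mem (φ k)), smul_zero])
          (by rw [norm_smul]; simp [hn.ne']) k
        rw [inner_smul_right, hidem, norm_mul, Complex.norm_real] at h1
        simp only [norm_inv, Complex.norm_real, norm_norm, norm_pow] at h1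
        have h2 : ‖u‖⁻¹ * ‖u‖ ^ 2 = ‖u‖ := by field_simp
        rw [h2] at h1
        gcongr
    have hsum : ((∑ k, ‖U.starProjection (φ k)‖ ^ 2 : ℝ) : ℂ) =
        ((P * ∑ i, w i * ‖U.starProjection (B i)‖ ^ 2 : ℝ) : ℂ) := by
      have hexp : ∀ k, inner ℂ (φ k) (U.starProjection (φ k)) =
          ∑ i, ∑ j, (star (φ k i) * φ k j) * inner ℂ (B i) (U.starProjection (B j)) := by
        intro k
        have hφ : φ k = ∑ i, φ k i • B i := by
          conv_lhs => rw [← B.sum_repr (φ k)]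
          simp [B]
        conv_lhs => rw [hφ]
        simp only [map_sum, map_smul, sum_inner, inner_sum, inner_smul_left, inner_smul_right]
        simp only [Finset.mul_sum]
        rw [Finset.sum_comm]
        refine Finset.sum_congr rfl fun i _ => Finset.sum_congr rfl fun j _ => ?_
        rw [Complex.star_def]
        ring
      rw [Complex.ofReal_sum]
      simp_rw [← hidem, hexp]
      rw [Finset.sum_comm]
      push_cast
      rw [Finset.mul_sum]
      refine Finset.sum_congr rfl fun i _ => ?_
      rw [Finset.sum_comm]
      simp_rw [← Finset.sum_mul, horth]
      simp only [ite_mul, zero_mul, Finset.sum_ite_eq, Finset.mem_univ, if_true]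
      rw [hidem]
      push_cast
      ring
    have hsum' : ∑ k, ‖U.starProjection (φ k)‖ ^ 2 =
        P * ∑ i, w i * ‖U.starProjection (B i)‖ ^ 2 := by exact_mod_cast hsum
    have hle : ∑ k, ‖U.starProjection (φ k)‖ ^ 2 ≤ P * E ^ 2 := by
      refine (Finset.sum_le_sum fun k _ => hk k).trans ?_
      simp
    rw [hsum'] at hle
    exact le_of_mul_le_mul_left hle (by exact_mod_cast hP)

theorem exists_compression_of_error_le {Λ : InfoClass} {n : ℕ}
    (hω : ∀ h : Fin s → ℤ, 0 < weight ω a b h)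
    (hS : Summable fun h : Fin s → ℤ => weight ω a b h) (A : Algorithm Λ ω a b n s) {E : ℝ}
    (hE0 : 0 ≤ E) (hE : A.error ≤ ENNReal.ofReal E) (F : Finset (Fin s → ℤ)) :
    ∃ p : F → ℝ, (∀ i, 0 ≤ p i ∧ p i ≤ 1) ∧ (F.card : ℝ) - n ≤ ∑ i, p i ∧
      ∑ i : F, weight ω a b i.1 * p i ≤ E ^ 2 := by
  classical
  obtain ⟨J, hJ⟩ := exists_coefficients hω hS
  obtain ⟨P, hP, g, hg⟩ := exists_separates F
  let incl : EuclideanSpace ℂ F →ₗ[ℂ] lp (fun _ : Fin s → ℤ => ℂ) 2 :=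
    { toFun := fun c => ∑ h : F, lp.single 2 h.1 (c h)
      map_add' := fun c d => by
        simp [lp.single_add, Finset.sum_add_distrib]
      map_smul' := fun r c => by
        simp only [PiLp.smul_apply, lp.single_smul, Finset.smul_sum, RingHom.id_apply] }
  have hincl : ∀ c (h : F), incl c h.1 = c h := by
    intro c h
    change (∑ h' : F, lp.single (E := fun _ : Fin s → ℤ => ℂ) 2 h'.1 (c h') :
      lp (fun _ : Fin s → ℤ => ℂ) 2) h.1 = c h
    rw [lp.coeFn_sum, Finset.sum_apply, Finset.sum_eq_single h]
    · simp
    · intro h' _ hne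
      have : h.1 ≠ h'.1 := fun e => hne (Subtype.ext e.symm)
      simp [this]
    · simp
  have hinner : ∀ (v : lp (fun _ : Fin s → ℤ => ℂ) 2) c,
      inner ℂ v (incl c) = ∑ h : F, star (v h.1) * c h := by
    intro v c
    change inner ℂ v (∑ h : F, lp.single 2 h.1 (c h)) = _
    rw [inner_sum]
    refine Finset.sum_congr rfl fun h _ => ?_
    rw [lp.inner_single_right]
    simp [mul_comm]
  have hnorm : ∀ c, ‖incl c‖ = ‖c‖ := by
    intro c
    rw [@norm_eq_sqrt_re_inner ℂ, @norm_eq_sqrt_re_inner ℂ, hinner, PiLp.inner_apply]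
    simp only [hincl, RCLike.inner_apply, Complex.star_def, mul_comm]
  have heval : ∀ c x, J.symm (incl c) x =
      ∑ h : F, (√(weight ω a b h.1) : ℂ) * c h * wave h.1 x := by
    intro c x
    rw [hJ, J.apply_symm_apply, hinner]
    refine Finset.sum_congr rfl fun h _ => ?_
    change star ((√(weight ω a b h.1) : ℂ) * star (wave h.1 x)) * c h = _
    simp
    ring
  let M : EuclideanSpace ℂ F →ₗ[ℂ] (Fin n → ℂ) :=
    LinearMap.pi fun k => (A.L k).toLinearMap ∘ₗ J.symm.toLinearEquiv.toLinearMap ∘ₗ incl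
  let φ : Fin P → EuclideanSpace ℂ F := fun k =>
    WithLp.toLp 2 fun h => feature hS (node P g k) h.1
  have horth : ∀ i j : F, ∑ k, star (φ k i) * φ k j =
      if i = j then (P : ℂ) * weight ω a b i.1 else 0 := by
    intro i j
    have e : ∀ k : Fin P, star (φ k i) * φ k j =
        (√(weight ω a b i.1) : ℂ) * √(weight ω a b j.1) *
          (star (wave j.1 (node P g k)) * wave i.1 (node P g k)) := by
      intro k
      change star ((√(weight ω a b i.1) : ℂ) * star (wave i.1 (node P g k))) *
        ((√(weight ω a b j.1) : ℂ) * star (wave j.1 (node P g k))) = _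
      simp
      ring
    rw [Finset.sum_congr rfl fun k _ => e k, ← Finset.mul_sum, sum_star_wave_mul_wave_node hP]
    by_cases hij : i = j
    · subst hij
      rw [← Complex.ofReal_mul, Real.mul_self_sqrt (weight_nonneg ω a b i.1)]
      simp [mul_comm]
    · rw [if_neg, if_neg hij, mul_zero]
      exact fun hd => hij (Subtype.ext (hg j.1 j.2 i.1 i.2 hd).symm)
  have hbound : ∀ c, M c = 0 → ‖c‖ ≤ 1 → ∀ k, ‖inner ℂ (φ k) c‖ ≤ E := by
    intro c hc hc1 k
    have hL : ∀ k, A.L k (J.symm (incl c)) = 0 := fun k => congrFun hc k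
    have h1 : ‖J.symm (incl c)‖ ≤ 1 := by rwa [J.symm.norm_map, hnorm]
    have h2 : eLpNorm (fun x => J.symm (incl c) x) ∞ (cubeMeasure s) ≤ ENNReal.ofReal E := by
      refine le_trans ?_ ((le_iSup₂ (f := fun (f : Space ω a b s) (_ : ‖f‖ ≤ 1) =>
        eLpNorm (fun x => f x - ∑ k, A.α k x * A.L k f) ∞ (cubeMeasure s)) _ h1).trans hE)
      simp [hL]
    have h3 : Continuous fun x => J.symm (incl c) x := by
      simp only [heval]
      exact continuous_finsetSum _ fun h _ => continuous_const.mul (continuous_wave _)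
    refine le_of_eq_of_le ?_ (norm_le_of_eLpNorm_le h3 hE0 h2 (node P g k))
    rw [hJ, J.apply_symm_apply, hinner, PiLp.inner_apply]
    simp [φ, mul_comm]
  obtain ⟨p, hp, hsum, hle⟩ :=
    exists_compression hP M φ (fun h => weight ω a b h.1) horth hbound
  exact ⟨p, hp, by simpa using hsum, hle⟩

/-- The `n`th minimal error is at least the square root of the `(n+1)`st largest weight. -/
theorem sqrt_le_minError {Λ : InfoClass} {n : ℕ}
    (hω : ∀ h : Fin s → ℤ, 0 < weight ω a b h)
    (hS : Summable fun h : Fin s → ℤ => weight ω a b h) {F : Finset (Fin s → ℤ)}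
    (hF : n < F.card) {r : ℝ} (hw : ∀ h ∈ F, r ^ 2 ≤ weight ω a b h) :
    ENNReal.ofReal r ≤ minError Λ ω a b n s := by
  refine le_iInf fun A => ?_
  by_contra! hlt
  set E := A.error.toReal with hE
  have hEr : ENNReal.ofReal E = A.error := ENNReal.ofReal_toReal hlt.ne_top
  obtain ⟨p, hp, hsum, hle⟩ := exists_compression_of_error_le hω hS A ENNReal.toReal_nonneg hEr.ge F
  have h1 : E < r := by
    rw [← hEr] at hlt
    exact (ENNReal.ofReal_lt_ofReal_iff_of_nonneg ENNReal.toReal_nonneg).mp hlt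
  have h2 : r ^ 2 * ∑ i, p i ≤ E ^ 2 := by
    rw [Finset.mul_sum]
    exact (Finset.sum_le_sum fun i _ =>
      mul_le_mul_of_nonneg_right (hw i.1 i.2) (hp i).1).trans hle
  have h3 : (1 : ℝ) ≤ ∑ i, p i := by
    have : (n : ℝ) + 1 ≤ F.card := by exact_mod_cast hF
    linarith
  have h4 : E ^ 2 < r ^ 2 := pow_lt_pow_left₀ h1 ENNReal.toReal_nonneg two_ne_zero
  nlinarith [sq_nonneg r]

/-- The squared `n`th minimal error is at least `∑ ω_h - n`, because no weight exceeds one. -/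
theorem sum_weight_le_of_minError_le {Λ : InfoClass} {n : ℕ}
    (hω : ∀ h : Fin s → ℤ, 0 < weight ω a b h) (hω1 : ∀ h : Fin s → ℤ, weight ω a b h ≤ 1)
    (hS : Summable fun h : Fin s → ℤ => weight ω a b h) {E : ℝ} (hE0 : 0 ≤ E)
    (hE : minError Λ ω a b n s ≤ ENNReal.ofReal E) (F : Finset (Fin s → ℤ)) :
    ∑ h ∈ F, weight ω a b h ≤ E ^ 2 + n := by
  have key : ∀ E' > E, ∑ h ∈ F, weight ω a b h ≤ E' ^ 2 + n := by
    intro E' hE'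
    have hlt : minError Λ ω a b n s < ENNReal.ofReal E' :=
      hE.trans_lt ((ENNReal.ofReal_lt_ofReal_iff_of_nonneg hE0).mpr hE')
    obtain ⟨A, hA⟩ := iInf_lt_iff.mp hlt
    obtain ⟨p, hp, hsum, hle⟩ :=
      exists_compression_of_error_le hω hS A (hE0.trans hE'.le) hA.le F
    have h1 : ∑ i : F, weight ω a b i.1 ≤ ∑ i : F, (weight ω a b i.1 * p i + (1 - p i)) := by
      refine Finset.sum_le_sum fun i _ => ?_
      nlinarith [hω1 i.1, (hp i).2]
    rw [Finset.sum_add_distrib, Finset.sum_sub_distrib] at h1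
    simp only [Finset.sum_const, Finset.card_univ, Fintype.card_coe, nsmul_eq_mul, mul_one] at h1
    rw [← Finset.sum_coe_sort]
    linarith
  have hlim : Tendsto (fun E' : ℝ => E' ^ 2 + (n : ℝ)) (𝓝[>] E) (𝓝 (E ^ 2 + n)) :=
    ((continuous_pow 2).add continuous_const).continuousWithinAt.tendsto
  exact ge_of_tendsto hlim (eventually_mem_nhdsWithin.mono fun E' hE' => key E' hE')

/-! ### Upper bounds for the minimal errors -/

/-- A bound for the part of a Fourier series that an algorithm misses. The function `D` holds the
errors on the single exponentials. -/
theorem norm_tsum_le (v : lp (fun _ : Fin s → ℤ => ℂ) 2) (F : Finset (Fin s → ℤ))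
    (D : (Fin s → ℤ) → ℂ) {m R : ℝ} (hm : 0 ≤ m) (hR : 0 ≤ R) (hD : ∀ l, ‖D l‖ ≤ m)
    (hDF : ∀ l ∈ F, D l = 0)
    (htail : ∀ G : Finset (Fin s → ℤ), Disjoint G F → ∑ h ∈ G, weight ω a b h ≤ R ^ 2) :
    ‖∑' l, (√(weight ω a b l) : ℂ) * v l * D l‖ ≤ m * R * ‖v‖ := by
  classical
  have hfin : ∀ G : Finset (Fin s → ℤ),
      ∑ l ∈ G, ‖(√(weight ω a b l) : ℂ) * v l * D l‖ ≤ m * R * ‖v‖ := by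
    intro G
    have h1 : ∑ l ∈ G, ‖(√(weight ω a b l) : ℂ) * v l * D l‖ =
        ∑ l ∈ G \ F, ‖(√(weight ω a b l) : ℂ) * v l * D l‖ := by
      refine (Finset.sum_subset Finset.sdiff_subset fun l hl hl' => ?_).symm
      have : l ∈ F := by simpa [hl] using hl'
      simp [hDF l this]
    have h2 : ∑ l ∈ G \ F, ‖(√(weight ω a b l) : ℂ) * v l * D l‖ ≤
        m * ∑ l ∈ G \ F, √(weight ω a b l) * ‖v l‖ := by
      rw [Finset.mul_sum]
      refine Finset.sum_le_sum fun l _ => ?_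
      rw [norm_mul, norm_mul, Complex.norm_real, Real.norm_eq_abs,
        abs_of_nonneg (Real.sqrt_nonneg _), mul_comm]
      exact mul_le_mul_of_nonneg_right (hD l) (by positivity)
    have h3 : ∑ l ∈ G \ F, √(weight ω a b l) * ‖v l‖ ≤ R * ‖v‖ := by
      refine (Real.sum_mul_le_sqrt_mul_sqrt _ _ _).trans ?_
      refine mul_le_mul ?_ ?_ (Real.sqrt_nonneg _) hR
      · refine Real.sqrt_le_iff.mpr ⟨hR, ?_⟩
        rw [Finset.sum_congr rfl fun l _ => Real.sq_sqrt (weight_nonneg ω a b l)]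
        exact htail _ Finset.sdiff_disjoint
      · refine Real.sqrt_le_iff.mpr ⟨norm_nonneg _, ?_⟩
        have := lp.sum_rpow_le_norm_rpow (p := 2) (by simp) v (G \ F)
        simpa using this
    rw [h1, mul_assoc]
    exact h2.trans (mul_le_mul_of_nonneg_left h3 hm)
  have hs : Summable fun l => ‖(√(weight ω a b l) : ℂ) * v l * D l‖ :=
    summable_of_sum_le (fun _ => norm_nonneg _) hfin
  exact (norm_tsum_le_tsum_norm hs).trans (hs.tsum_le_of_sum_le hfin)

theorem error_le_of_forall {Λ : InfoClass} {n : ℕ} (A : Algorithm Λ ω a b n s) {E : ℝ}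
    (h : ∀ f : Space ω a b s, ‖f‖ ≤ 1 → ∀ x, ‖f x - ∑ k, A.α k x * A.L k f‖ ≤ E) :
    A.error ≤ ENNReal.ofReal E := by
  refine iSup₂_le fun f hf => ?_
  rw [eLpNorm_exponent_top]
  refine eLpNormEssSup_le_of_ae_bound (Eventually.of_forall fun x => h f hf x)

/-- The initial error is at most the square root of the kernel diagonal. -/
theorem minError_zero_le (Λ : InfoClass) (hω : ∀ h : Fin s → ℤ, 0 < weight ω a b h)
    (hS : Summable fun h : Fin s → ℤ => weight ω a b h) {R : ℝ} (hR : 0 ≤ R)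
    (hsum : ∀ G : Finset (Fin s → ℤ), ∑ h ∈ G, weight ω a b h ≤ R ^ 2) :
    minError Λ ω a b 0 s ≤ ENNReal.ofReal R := by
  obtain ⟨J, hJ⟩ := exists_coefficients hω hS
  let A : Algorithm Λ ω a b 0 s := ⟨Fin.elim0, fun k => k.elim0, Fin.elim0, fun k => k.elim0⟩
  refine (iInf_le _ A).trans (error_le_of_forall A fun f hf x => ?_)
  rw [Finset.univ_eq_empty, Finset.sum_empty, sub_zero, hJ,
    ← (hasSum_inner_feature hS x (J f)).tsum_eq]
  refine (norm_tsum_le (J f) ∅ (fun h => wave h x) zero_le_one hR (fun l => (norm_wave l x).le)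
    (by simp) fun G _ => hsum G).trans ?_
  rw [J.norm_map, one_mul]
  exact mul_le_of_le_one_right hR hf

/-- Point evaluation on the Korobov space. -/
def evalAt (x : Cube s) : Space ω a b s →L[ℂ] ℂ :=
  (ContinuousLinearMap.proj x).comp (RKHS.coeCLM ℂ)

theorem permits_evalAt (Λ : InfoClass) (x : Cube s) :
    Λ.Permits (evalAt x : Space ω a b s →L[ℂ] ℂ) := by
  cases Λ
  · trivial
  · exact ⟨x, fun f => rfl⟩

theorem minError_antitone (Λ : InfoClass) (ω : Set.Ioo (0 : ℝ) 1) (a b : ℕ → ℝ) (s : ℕ) :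
    Antitone fun n => minError Λ ω a b n s := by
  refine antitone_nat_of_succ_le fun n => le_iInf fun A => ?_
  let A' : Algorithm Λ ω a b (n + 1) s :=
    { α := Fin.cons 0 A.α
      memLp := fun k => by
        refine Fin.cases ?_ (fun i => ?_) k
        · simp
        · simpa using A.memLp i
      L := Fin.cons (evalAt ⟨0, by simp⟩) A.L
      permits := fun k => by
        refine Fin.cases ?_ (fun i => ?_) k
        · exact permits_evalAt Λ _
        · simpa using A.permits i }
  refine (iInf_le _ A').trans (le_of_eq ?_)
  simp [Algorithm.error, A', Fin.sum_univ_succ]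

/-- Trigonometric interpolation with frequencies `F` on a lattice that separates `F`. The lattice
sums reproduce the exponentials in `F` and send every other one to zero or to a single exponential
in `F`, so that the error is at most twice the norm of the tail. -/
theorem minError_le_of_separates (Λ : InfoClass) (hω : ∀ h : Fin s → ℤ, 0 < weight ω a b h)
    (hS : Summable fun h : Fin s → ℤ => weight ω a b h) {P : ℕ} (hP : 0 < P) {g : Fin s → ℤ}
    {F : Finset (Fin s → ℤ)} (hg : Separates P g F) {R : ℝ} (hR : 0 ≤ R)
    (htail : ∀ G : Finset (Fin s → ℤ), Disjoint G F → ∑ h ∈ G, weight ω a b h ≤ R ^ 2) :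
    minError Λ ω a b P s ≤ ENNReal.ofReal (2 * R) := by
  classical
  obtain ⟨J, hJ⟩ := exists_coefficients hω hS
  have hP0 : (P : ℂ) ≠ 0 := by exact_mod_cast hP.ne'
  let α : Fin P → Cube s → ℂ := fun k x =>
    ∑ h ∈ F, (P : ℂ)⁻¹ * star (wave h (node P g k)) * wave h x
  have hα : ∀ k, Continuous (α k) := fun k =>
    continuous_finsetSum _ fun h _ => continuous_const.mul (continuous_wave h)
  let A : Algorithm Λ ω a b P s :=
    { α := α
      memLp := fun k => by
        refine memLp_top_of_bound (hα k).aestronglyMeasurable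
          (∑ h ∈ F, ‖(P : ℂ)⁻¹ * star (wave h (node P g k))‖)
          (Eventually.of_forall fun x => (norm_sum_le _ _).trans (le_of_eq ?_))
        refine Finset.sum_congr rfl fun h _ => ?_
        rw [norm_mul _ (wave h x), norm_wave, mul_one]
      L := fun k => evalAt (node P g k)
      permits := fun k => permits_evalAt Λ _ }
  refine (iInf_le _ A).trans (error_le_of_forall A fun f hf x => ?_)
  let D : (Fin s → ℤ) → ℂ := fun l =>
    wave l x - ∑ h ∈ F, if (P : ℤ) ∣ (l - h) ⬝ᵥ g then wave h x else 0
  have hαl : ∀ l, ∑ k, α k x * wave l (node P g k) =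
      ∑ h ∈ F, if (P : ℤ) ∣ (l - h) ⬝ᵥ g then wave h x else 0 := by
    intro l
    simp only [α, Finset.sum_mul]
    rw [Finset.sum_comm]
    refine Finset.sum_congr rfl fun h _ => ?_
    have e : ∀ k : Fin P, (P : ℂ)⁻¹ * star (wave h (node P g k)) * wave h x *
        wave l (node P g k) = (P : ℂ)⁻¹ * wave h x *
          (star (wave h (node P g k)) * wave l (node P g k)) := fun k => by ring
    rw [Finset.sum_congr rfl fun k _ => e k, ← Finset.mul_sum, sum_star_wave_mul_wave_node hP]
    split_ifs
    · field_simp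
    · simp
  have hsum : f x - ∑ k, α k x * f (node P g k) =
      ∑' l, (√(weight ω a b l) : ℂ) * J f l * D l := by
    have h1 : ∀ y, HasSum (fun l => (√(weight ω a b l) : ℂ) * J f l * wave l y) (f y) := by
      intro y
      rw [hJ]
      exact hasSum_inner_feature hS y (J f)
    refine (HasSum.tsum_eq ?_).symm
    refine ((h1 x).sub (hasSum_sum (s := Finset.univ) fun (k : Fin P) _ =>
      (h1 (node P g k)).mul_left (α k x))).congr_fun fun l => ?_
    simp only [D, ← hαl, mul_sub, Finset.mul_sum]
    congr 1
    exact Finset.sum_congr rfl fun k _ => by ring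
  have hself : ∀ l ∈ F, ∀ h ∈ F, h ≠ l → ¬ (P : ℤ) ∣ (l - h) ⬝ᵥ g :=
    fun l hl h hh hne hd => hne (hg h hh l hl hd)
  have hDF : ∀ l ∈ F, D l = 0 := by
    intro l hl
    simp only [D]
    rw [Finset.sum_eq_single_of_mem l hl fun h hh hne => if_neg (hself l hl h hh hne)]
    simp
  have hD : ∀ l, ‖D l‖ ≤ 2 := by
    intro l
    have h1 : ‖∑ h ∈ F, if (P : ℤ) ∣ (l - h) ⬝ᵥ g then wave h x else 0‖ ≤ 1 := by
      by_cases hex : ∃ h₀ ∈ F, (P : ℤ) ∣ (l - h₀) ⬝ᵥ g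
      · obtain ⟨h₀, hh₀, hd₀⟩ := hex
        rw [Finset.sum_eq_single_of_mem h₀ hh₀, if_pos hd₀, norm_wave]
        intro h hh hne
        refine if_neg fun hd => hself h₀ hh₀ h hh hne ?_
        have : (h₀ - h) ⬝ᵥ g = (l - h) ⬝ᵥ g - (l - h₀) ⬝ᵥ g := by
          simp [sub_dotProduct]
        rw [this]
        exact dvd_sub hd hd₀
      · push Not at hex
        rw [Finset.sum_eq_zero fun h hh => if_neg (hex h hh)]
        simp
    calc ‖D l‖ ≤ ‖wave l x‖ + _ := norm_sub_le _ _
      _ ≤ 1 + 1 := add_le_add (norm_wave l x).le h1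
      _ = 2 := by norm_num
  change ‖f x - ∑ k, α k x * f (node P g k)‖ ≤ 2 * R
  rw [hsum]
  refine (norm_tsum_le (J f) F D zero_le_two hR hD hDF htail).trans ?_
  rw [J.norm_map]
  exact mul_le_of_le_one_right (by positivity) hf

/-! ### The weights and their sums -/

/-- The number `∑ a_j |h_j|^{b_j}`, so that `ω_h = ω ^ exponent`. -/
def exponent (a b : ℕ → ℝ) (h : Fin s → ℤ) : ℝ :=
  ∑ j : Fin s, a j * |(h j : ℝ)| ^ b j

/-- The positive number `log ω⁻¹`. -/
def decay (ω : Set.Ioo (0 : ℝ) 1) : ℝ := -Real.log ω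

theorem decay_pos (ω : Set.Ioo (0 : ℝ) 1) : 0 < decay ω :=
  neg_pos.mpr (Real.log_neg ω.2.1 ω.2.2)

theorem weight_eq_exp (ω : Set.Ioo (0 : ℝ) 1) (a b : ℕ → ℝ) (h : Fin s → ℤ) :
    weight ω a b h = Real.exp (-(decay ω * exponent a b h)) := by
  rw [weight, Real.rpow_def_of_pos ω.2.1, decay, exponent]
  congr 1
  ring

theorem weight_pos (ω : Set.Ioo (0 : ℝ) 1) (a b : ℕ → ℝ) (h : Fin s → ℤ) :
    0 < weight ω a b h := by
  rw [weight_eq_exp]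
  positivity

theorem exponent_nonneg (ha : ∀ j, 0 < a j) (h : Fin s → ℤ) : 0 ≤ exponent a b h :=
  Finset.sum_nonneg fun j _ => mul_nonneg (ha j).le (by positivity)

theorem weight_le_one (ω : Set.Ioo (0 : ℝ) 1) (ha : ∀ j, 0 < a j) (h : Fin s → ℤ) :
    weight ω a b h ≤ 1 := by
  rw [weight_eq_exp, Real.exp_le_one_iff, neg_nonpos]
  exact mul_nonneg (decay_pos ω).le (exponent_nonneg ha h)

theorem summable_exp_neg_mul_rpow {c β : ℝ} (hc : 0 < c) (hβ : 0 < β) :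
    Summable fun n : ℕ => Real.exp (-(c * (n : ℝ) ^ β)) := by
  have h1 := (isLittleO_exp_neg_mul_rpow_atTop hc (-2 / β)).isBigO.comp_tendsto
    ((tendsto_rpow_atTop hβ).comp tendsto_natCast_atTop_atTop)
  refine summable_of_isBigO_nat (g := fun n : ℕ => (n : ℝ) ^ (-2 : ℝ))
    (Real.summable_nat_rpow.mpr (by norm_num)) ?_
  refine (h1.congr_left fun n => ?_).congr_right fun n => ?_
  · simp [Function.comp]
  · simp only [Function.comp]
    rw [← Real.rpow_mul n.cast_nonneg]
    congr 1
    field_simp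

theorem exists_sum_exp_int_le {a₀ β c : ℝ} (ha₀ : 0 < a₀) (hβ : 0 < β) (hc : 0 < c) :
    ∃ D : ℝ, 0 ≤ D ∧ ∀ A, a₀ ≤ A → ∀ B, β ≤ B → ∀ G : Finset ℤ,
      ∑ k ∈ G, Real.exp (-(c * (A * |(k : ℝ)| ^ B))) ≤ 1 + D * Real.exp (-(c * A)) := by
  classical
  let u : ℤ → ℝ := fun k => Real.exp (-(c * a₀ * |(k : ℝ)| ^ β))
  have hu : Summable u := by
    have h1 := summable_exp_neg_mul_rpow (mul_pos hc ha₀) hβ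
    refine Summable.of_nat_of_neg ?_ ?_ <;> simpa [u] using h1
  have hu0 : ∀ k, 0 ≤ u k := fun k => (Real.exp_pos _).le
  refine ⟨Real.exp (c * a₀) * ∑' k, u k, mul_nonneg (Real.exp_pos _).le (tsum_nonneg hu0),
    fun A hA B hB G => ?_⟩
  have hterm : ∀ k : ℤ, k ≠ 0 → Real.exp (-(c * (A * |(k : ℝ)| ^ B))) ≤
      Real.exp (c * a₀) * Real.exp (-(c * A)) * u k := by
    intro k hk
    have h1 : (1 : ℝ) ≤ |(k : ℝ)| := by exact_mod_cast Int.one_le_abs hk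
    have h2 : |(k : ℝ)| ^ β ≤ |(k : ℝ)| ^ B := Real.rpow_le_rpow_of_exponent_le h1 hB
    have h3 : 1 ≤ |(k : ℝ)| ^ β := Real.one_le_rpow h1 hβ.le
    rw [← Real.exp_add, ← Real.exp_add, Real.exp_le_exp]
    have h4 : A - a₀ + a₀ * |(k : ℝ)| ^ β ≤ A * |(k : ℝ)| ^ B := by
      have : A * |(k : ℝ)| ^ β ≤ A * |(k : ℝ)| ^ B :=
        mul_le_mul_of_nonneg_left h2 (ha₀.le.trans hA)
      nlinarith
    nlinarith
  have hG : ∑ k ∈ G.erase 0, Real.exp (-(c * (A * |(k : ℝ)| ^ B))) ≤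
      Real.exp (c * a₀) * Real.exp (-(c * A)) * ∑' k, u k := by
    refine (Finset.sum_le_sum fun k hk => hterm k (Finset.ne_of_mem_erase hk)).trans ?_
    rw [← Finset.mul_sum]
    exact mul_le_mul_of_nonneg_left (hu.sum_le_tsum _ fun k _ => hu0 k) (by positivity)
  have hsub : ∑ k ∈ G, Real.exp (-(c * (A * |(k : ℝ)| ^ B))) ≤
      ∑ k ∈ insert 0 (G.erase 0), Real.exp (-(c * (A * |(k : ℝ)| ^ B))) :=
    Finset.sum_le_sum_of_subset_of_nonneg (Finset.insert_erase_subset 0 G)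
      fun _ _ _ => (Real.exp_pos _).le
  rw [Finset.sum_insert (Finset.notMem_erase 0 G)] at hsub
  have h0 : Real.exp (-(c * (A * |((0 : ℤ) : ℝ)| ^ B))) = 1 := by
    simp [Real.zero_rpow (hβ.trans_le hB).ne']
  rw [h0] at hsub
  calc _ ≤ _ := hsub
    _ ≤ 1 + Real.exp (c * a₀) * Real.exp (-(c * A)) * ∑' k, u k := by gcongr
    _ = _ := by ring

/-- Sums of powers of the weights grow at most exponentially in `∑ exp (-c a_j)`. -/
theorem exists_sum_exp_exponent_le {a₀ β c : ℝ} (ha₀ : 0 < a₀) (ha : ∀ j, a₀ ≤ a j) (hβ : 0 < β)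
    (hb : ∀ j, β ≤ b j) (hc : 0 < c) :
    ∃ D : ℝ, 0 ≤ D ∧ ∀ (s : ℕ) (F : Finset (Fin s → ℤ)),
      ∑ h ∈ F, Real.exp (-(c * exponent a b h)) ≤
        Real.exp (D * ∑ j ∈ Finset.range s, Real.exp (-(c * a j))) := by
  classical
  obtain ⟨D, hD0, hD⟩ := exists_sum_exp_int_le ha₀ hβ hc
  refine ⟨D, hD0, fun s F => ?_⟩
  let t : Fin s → Finset ℤ := fun j => F.image fun h => h j
  have hsub : F ⊆ Fintype.piFinset t := fun h hh =>
    Fintype.mem_piFinset.mpr fun j => Finset.mem_image_of_mem _ hh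
  calc ∑ h ∈ F, Real.exp (-(c * exponent a b h))
      ≤ ∑ h ∈ Fintype.piFinset t, Real.exp (-(c * exponent a b h)) :=
        Finset.sum_le_sum_of_subset_of_nonneg hsub fun _ _ _ => (Real.exp_pos _).le
    _ = ∏ j : Fin s, ∑ k ∈ t j, Real.exp (-(c * (a j * |(k : ℝ)| ^ b j))) := by
        rw [Finset.prod_univ_sum]
        refine Finset.sum_congr rfl fun h _ => ?_
        rw [← Real.exp_sum, exponent, Finset.mul_sum, Finset.sum_neg_distrib]
    _ ≤ ∏ j : Fin s, Real.exp (D * Real.exp (-(c * a j))) := by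
        refine Finset.prod_le_prod (fun j _ => Finset.sum_nonneg fun _ _ => (Real.exp_pos _).le)
          fun j _ => (hD _ (ha j) _ (hb j) _).trans ?_
        rw [add_comm]
        exact Real.add_one_le_exp _
    _ = _ := by
        rw [← Real.exp_sum, ← Finset.mul_sum,
          Fin.sum_univ_eq_sum_range fun j => Real.exp (-(c * a j))]

theorem summable_weight {a₀ β : ℝ} (ha₀ : 0 < a₀) (ha : ∀ j, a₀ ≤ a j) (hβ : 0 < β)
    (hb : ∀ j, β ≤ b j) : Summable fun h : Fin s → ℤ => weight ω a b h := by
  obtain ⟨D, -, hD⟩ := exists_sum_exp_exponent_le ha₀ ha hβ hb (decay_pos ω)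
  refine summable_of_sum_le (c := Real.exp (D * ∑ j ∈ Finset.range s, Real.exp (-(decay ω * a j))))
    (fun h => (weight_pos ω a b h).le) fun F => ?_
  simp only [weight_eq_exp]
  exact hD s F

/-- The initial error grows at most exponentially in `s`. -/
theorem exists_minError_zero_le {a₀ β : ℝ} (ha₀ : 0 < a₀) (ha : ∀ j, a₀ ≤ a j) (hβ : 0 < β)
    (hb : ∀ j, β ≤ b j) (ω : Set.Ioo (0 : ℝ) 1) (Λ : InfoClass) :
    ∃ C : ℝ, 0 ≤ C ∧ ∀ s : ℕ, minError Λ ω a b 0 s ≤ ENNReal.ofReal (Real.exp (C * s)) := by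
  obtain ⟨D, hD0, hD⟩ := exists_sum_exp_exponent_le ha₀ ha hβ hb (decay_pos ω)
  refine ⟨D, hD0, fun s => minError_zero_le Λ (weight_pos ω a b) (summable_weight ha₀ ha hβ hb)
    (Real.exp_pos _).le fun G => ?_⟩
  simp only [weight_eq_exp]
  refine (hD s G).trans ?_
  rw [← Real.exp_nat_mul, Real.exp_le_exp]
  have h1 : ∑ j ∈ Finset.range s, Real.exp (-(decay ω * a j)) ≤ s := by
    refine (Finset.sum_le_card_nsmul _ _ 1 fun j _ => ?_).trans (by simp)
    rw [Real.exp_le_one_iff, neg_nonpos]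
    exact mul_nonneg (decay_pos ω).le (ha₀.le.trans (ha j))
  have h2 := mul_le_mul_of_nonneg_left h1 hD0
  have h3 : 0 ≤ D * s := by positivity
  push_cast
  linarith

theorem one_le_minError_zero {a₀ β : ℝ} (ha₀ : 0 < a₀) (ha : ∀ j, a₀ ≤ a j) (hβ : 0 < β)
    (hb : ∀ j, β ≤ b j) (ω : Set.Ioo (0 : ℝ) 1) (Λ : InfoClass) (s : ℕ) :
    1 ≤ minError Λ ω a b 0 s := by
  have h := sqrt_le_minError (Λ := Λ) (n := 0) (weight_pos ω a b)
    (summable_weight ha₀ ha hβ hb) (F := {(0 : Fin s → ℤ)}) (by simp) (r := 1) (by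
      intro h hh
      rw [Finset.mem_singleton.mp hh, weight_eq_exp]
      have : exponent a b (0 : Fin s → ℤ) = 0 := by
        refine Finset.sum_eq_zero fun j _ => ?_
        simp [Real.zero_rpow (hβ.trans_le (hb j)).ne']
      simp [this])
  simpa using h

/-- More than `n` frequencies of exponent at most `T` force the `n`th minimal error to be at least
`ω ^ (T / 2)`. -/
theorem exp_le_minError {a₀ β : ℝ} (ha₀ : 0 < a₀) (ha : ∀ j, a₀ ≤ a j) (hβ : 0 < β)
    (hb : ∀ j, β ≤ b j) {Λ : InfoClass} {n : ℕ} {F : Finset (Fin s → ℤ)} (hF : n < F.card) {T : ℝ}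
    (hT : ∀ h ∈ F, exponent a b h ≤ T) :
    ENNReal.ofReal (Real.exp (-(decay ω * T / 2))) ≤ minError Λ ω a b n s := by
  refine sqrt_le_minError (weight_pos ω a b) (summable_weight ha₀ ha hβ hb) hF fun h hh => ?_
  rw [weight_eq_exp, ← Real.exp_nat_mul, Real.exp_le_exp]
  have := mul_le_mul_of_nonneg_left (hT h hh) (decay_pos ω).le
  push_cast
  linarith

/-- The error of interpolation on a lattice that separates a set of frequencies containing all those
of exponent at most `T`. Half of the weight pays for the factor `ω ^ (T / 4)`, the other half for
summability. -/
theorem exists_minError_le_of_separates {a₀ β : ℝ} (ha₀ : 0 < a₀) (ha : ∀ j, a₀ ≤ a j)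
    (hβ : 0 < β) (hb : ∀ j, β ≤ b j) (ω : Set.Ioo (0 : ℝ) 1) (Λ : InfoClass) :
    ∃ D : ℝ, 0 ≤ D ∧ ∀ (s : ℕ) (T : ℝ) (F : Finset (Fin s → ℤ)) (P : ℕ) (g : Fin s → ℤ), 0 < P →
      Separates P g F → (∀ h, exponent a b h ≤ T → h ∈ F) →
      minError Λ ω a b P s ≤ ENNReal.ofReal (2 * Real.exp
        (D * ∑ j ∈ Finset.range s, Real.exp (-(decay ω / 2 * a j)) - decay ω * T / 4)) := by
  obtain ⟨D, hD0, hD⟩ := exists_sum_exp_exponent_le ha₀ ha hβ hb (half_pos (decay_pos ω))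
  refine ⟨D, hD0, fun s T F P g hP hg hF => minError_le_of_separates Λ (weight_pos ω a b)
    (summable_weight ha₀ ha hβ hb) hP hg (Real.exp_pos _).le fun G hG => ?_⟩
  have h1 : ∀ h ∈ G, weight ω a b h ≤
      Real.exp (-(decay ω * T / 2)) * Real.exp (-(decay ω / 2 * exponent a b h)) := by
    intro h hh
    have h2 : T < exponent a b h := by
      by_contra! hle
      exact Finset.disjoint_left.mp hG hh (hF h hle)
    rw [weight_eq_exp, ← Real.exp_add, Real.exp_le_exp]
    have := mul_le_mul_of_nonneg_left h2.le (decay_pos ω).le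
    linarith
  refine (Finset.sum_le_sum h1).trans ?_
  rw [← Finset.mul_sum]
  refine (mul_le_mul_of_nonneg_left (hD s G) (Real.exp_pos _).le).trans ?_
  rw [← Real.exp_add, ← Real.exp_nat_mul, Real.exp_le_exp]
  have h3 : 0 ≤ D * ∑ j ∈ Finset.range s, Real.exp (-(decay ω / 2 * a j)) :=
    mul_nonneg hD0 (Finset.sum_nonneg fun _ _ => (Real.exp_pos _).le)
  push_cast
  linarith

/-! ### Boxes of frequencies -/

/-- The largest modulus of the `j`th component of a frequency of exponent at most `T`. -/
def side (a b : ℕ → ℝ) (T : ℝ) (j : ℕ) : ℕ := ⌊(T / a j) ^ (1 / b j)⌋₊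

theorem abs_le_side (ha : ∀ j, 0 < a j) (hb : ∀ j, 0 < b j) {T : ℝ} {h : Fin s → ℤ}
    (hT : exponent a b h ≤ T) (j : Fin s) : |h j| ≤ side a b T j := by
  have h1 : a j * |(h j : ℝ)| ^ b j ≤ T := by
    refine le_trans ?_ hT
    exact Finset.single_le_sum (f := fun j : Fin s => a j * |(h j : ℝ)| ^ b j)
      (fun i _ => mul_nonneg (ha i).le (by positivity)) (Finset.mem_univ j)
  have h2 : |(h j : ℝ)| ^ b j ≤ T / a j := by
    rw [le_div_iff₀ (ha j)]
    linarith
  have h3 : |(h j : ℝ)| ≤ (T / a j) ^ (1 / b j) := by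
    have := Real.rpow_le_rpow (by positivity) h2 (one_div_nonneg.mpr (hb j).le)
    rwa [← Real.rpow_mul (abs_nonneg _), mul_one_div_cancel (hb j).ne', Real.rpow_one] at this
  have h4 : (h j).natAbs ≤ side a b T j := by
    refine Nat.le_floor ?_
    rwa [Nat.cast_natAbs, Int.cast_abs]
  rw [Int.abs_eq_natAbs]
  exact_mod_cast h4

/-- The number of points of the lattice that separates the box of frequencies with sides
`side a b T j`. -/
def boxCard (a b : ℕ → ℝ) (T : ℝ) (s : ℕ) : ℕ := ∏ j ∈ Finset.range s, (2 * side a b T j + 1)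

theorem boxCard_pos (a b : ℕ → ℝ) (T : ℝ) (s : ℕ) : 0 < boxCard a b T s :=
  Finset.prod_pos fun j _ => by omega

theorem exists_minError_boxCard_le {a₀ β : ℝ} (ha₀ : 0 < a₀) (ha : ∀ j, a₀ ≤ a j)
    (hβ : 0 < β) (hb : ∀ j, β ≤ b j) (ω : Set.Ioo (0 : ℝ) 1) (Λ : InfoClass) :
    ∃ D : ℝ, 0 ≤ D ∧ ∀ (s : ℕ) (T : ℝ),
      minError Λ ω a b (boxCard a b T s) s ≤ ENNReal.ofReal (2 * Real.exp
        (D * ∑ j ∈ Finset.range s, Real.exp (-(decay ω / 2 * a j)) - decay ω * T / 4)) := by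
  obtain ⟨D, hD0, hD⟩ := exists_minError_le_of_separates ha₀ ha hβ hb ω Λ
  refine ⟨D, hD0, fun s T => ?_⟩
  let F : Finset (Fin s → ℤ) := Fintype.piFinset fun j : Fin s =>
    Finset.Icc (-(side a b T j : ℤ)) (side a b T j)
  have hF : ∀ h, h ∈ F ↔ ∀ j, |h j| ≤ side a b T j := by
    intro h
    simp only [F, Fintype.mem_piFinset, Finset.mem_Icc, abs_le]
  obtain ⟨g, hg⟩ := exists_separates_box (fun j : Fin s => side a b T j) F fun h hh => (hF h).mp hh
  have hcard : ∏ j : Fin s, (2 * side a b T j + 1) = boxCard a b T s :=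
    Fin.prod_univ_eq_prod_range (fun j => 2 * side a b T j + 1) s
  rw [hcard] at hg
  exact hD s T F _ g (boxCard_pos a b T s) hg fun h hh => (hF h).mpr
    (abs_le_side (fun j => ha₀.trans_le (ha j)) (fun j => hβ.trans_le (hb j)) hh)

/-- The `j`th factor of `boxCard` is one if `T < a_j`; otherwise rounding costs at most a factor
three. -/
theorem two_mul_side_add_one_le {a₀ : ℝ} (ha₀ : 0 < a₀) (ha : ∀ j, a₀ ≤ a j) (hb : ∀ j, 0 < b j)
    {T : ℝ} (hT : a₀ ≤ T) (j : ℕ) :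
    ((2 * side a b T j + 1 : ℕ) : ℝ) ≤ (if a j ≤ T then 3 else 1) * (T / a₀) ^ (1 / b j) := by
  have hT0 : 0 < T := ha₀.trans_le hT
  have haj : 0 < a j := ha₀.trans_le (ha j)
  have hbj : 0 < 1 / b j := one_div_pos.mpr (hb j)
  have h1 : 1 ≤ (T / a₀) ^ (1 / b j) := Real.one_le_rpow ((one_le_div ha₀).mpr hT) hbj.le
  split_ifs with h
  · have h2 : (side a b T j : ℝ) ≤ (T / a j) ^ (1 / b j) := Nat.floor_le (by positivity)
    have h3 : (T / a j) ^ (1 / b j) ≤ (T / a₀) ^ (1 / b j) := by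
      gcongr
      exact ha j
    push_cast
    linarith
  · have h2 : side a b T j = 0 := by
      refine Nat.floor_eq_zero.mpr (Real.rpow_lt_one (by positivity) ?_ hbj)
      rw [div_lt_one haj]
      exact not_le.mp h
    rw [h2]
    simpa using h1

theorem boxCard_le {a₀ : ℝ} (ha₀ : 0 < a₀) (ha : ∀ j, a₀ ≤ a j) (hb : ∀ j, 0 < b j)
    {T : ℝ} (hT : a₀ ≤ T) (s : ℕ) :
    (boxCard a b T s : ℝ) ≤ 3 ^ ((Finset.range s).filter fun j => a j ≤ T).card *
      (T / a₀) ^ (∑ j ∈ Finset.range s, 1 / b j) := by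
  rw [boxCard, Nat.cast_prod]
  refine (Finset.prod_le_prod (fun _ _ => Nat.cast_nonneg _) fun j _ =>
    two_mul_side_add_one_le ha₀ ha hb hT j).trans (le_of_eq ?_)
  rw [Finset.prod_mul_distrib, ← Real.rpow_sum_of_pos (div_pos (ha₀.trans_le hT) ha₀)]
  congr 1
  rw [Finset.prod_ite]
  simp

/-! ### Rates of exponential convergence -/

/-- The number of frequencies of exponent at most `T` grows at least like `T ^ ∑ 1 / b_j`. -/
theorem exists_le_card (ha : ∀ j, 0 < a j) (hb : ∀ j, 0 < b j) (hs : 1 ≤ s) :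
    ∃ c : ℝ, 0 < c ∧ ∀ T : ℝ, 0 < T → ∃ F : Finset (Fin s → ℤ), (∀ h ∈ F, exponent a b h ≤ T) ∧
      c * T ^ (∑ j ∈ Finset.range s, 1 / b j) ≤ F.card := by
  have hs0 : (0 : ℝ) < s := by exact_mod_cast hs
  refine ⟨∏ j : Fin s, (1 / (s * a j)) ^ (1 / b j), Finset.prod_pos fun j _ =>
    Real.rpow_pos_of_pos (one_div_pos.mpr (mul_pos hs0 (ha j))) _, fun T hT => ?_⟩
  refine ⟨Fintype.piFinset fun j : Fin s => Finset.Icc 0 (side a b (T / s) j : ℤ), ?_, ?_⟩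
  · intro h hh
    have h1 : ∀ j : Fin s, a j * |(h j : ℝ)| ^ b j ≤ T / s := by
      intro j
      have hj := Finset.mem_Icc.mp (Fintype.mem_piFinset.mp hh j)
      have h2 : |(h j : ℝ)| ≤ (T / s / a j) ^ (1 / b j) := by
        have h3 : (side a b (T / s) j : ℝ) ≤ (T / s / a j) ^ (1 / b j) :=
          Nat.floor_le (Real.rpow_nonneg (div_pos (div_pos hT hs0) (ha j)).le _)
        rw [abs_of_nonneg (by exact_mod_cast hj.1)]
        exact le_trans (by exact_mod_cast hj.2) h3
      have h4 := Real.rpow_le_rpow (abs_nonneg _) h2 (hb j).le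
      rw [← Real.rpow_mul (div_pos (div_pos hT hs0) (ha j)).le, one_div_mul_cancel (hb j).ne',
        Real.rpow_one, le_div_iff₀ (ha j)] at h4
      linarith
    refine (Finset.sum_le_sum fun j _ => h1 j).trans (le_of_eq ?_)
    simp only [Finset.sum_const, Finset.card_univ, Fintype.card_fin, nsmul_eq_mul]
    field_simp
  · rw [Fintype.card_piFinset, Nat.cast_prod, ← Fin.sum_univ_eq_sum_range (fun j => 1 / b j),
      Real.rpow_sum_of_pos hT, ← Finset.prod_mul_distrib]
    refine Finset.prod_le_prod (fun j _ => ?_) fun j _ => ?_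
    · have := ha j
      positivity
    · have hpos : 0 < 1 / (s * a j) := one_div_pos.mpr (mul_pos hs0 (ha j))
      rw [← Real.mul_rpow hpos.le hT.le]
      have e : 1 / (s * a j) * T = T / s / a j := by
        have := (ha j).ne'
        field_simp
      rw [e, Int.card_Icc]
      have h1 : ((side a b (T / s) j : ℤ) + 1 - 0).toNat = side a b (T / s) j + 1 := by omega
      rw [h1]
      push_cast
      exact (Nat.lt_floor_add_one _).le

theorem sum_one_div_pos (hb : ∀ j, 0 < b j) (hs : 1 ≤ s) :
    0 < ∑ j ∈ Finset.range s, 1 / b j :=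
  Finset.sum_pos (fun j _ => one_div_pos.mpr (hb j)) ⟨0, Finset.mem_range.mpr hs⟩

theorem exists_exp_le_minError {a₀ β : ℝ} (ha₀ : 0 < a₀) (ha : ∀ j, a₀ ≤ a j) (hβ : 0 < β)
    (hb : ∀ j, β ≤ b j) (ω : Set.Ioo (0 : ℝ) 1) (Λ : InfoClass) (hs : 1 ≤ s) :
    ∃ c : ℝ, 0 < c ∧ ∀ n : ℕ, 1 ≤ n →
      ENNReal.ofReal (Real.exp (-(c * (n : ℝ) ^ (1 / ∑ j ∈ Finset.range s, 1 / b j)))) ≤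
        minError Λ ω a b n s := by
  have hb' : ∀ j, 0 < b j := fun j => hβ.trans_le (hb j)
  obtain ⟨c, hc, H⟩ := exists_le_card (fun j => ha₀.trans_le (ha j)) hb' hs
  set B := ∑ j ∈ Finset.range s, 1 / b j
  have hB : 0 < B := sum_one_div_pos hb' hs
  refine ⟨decay ω / 2 * (2 / c) ^ (1 / B),
    mul_pos (half_pos (decay_pos ω)) (Real.rpow_pos_of_pos (by positivity) _), fun n hn => ?_⟩
  have hn0 : (0 : ℝ) < n := by exact_mod_cast hn
  obtain ⟨F, hF, hcard⟩ := H ((2 / c * n) ^ (1 / B)) (by positivity)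
  rw [← Real.rpow_mul (by positivity), one_div_mul_cancel hB.ne', Real.rpow_one] at hcard
  have e : c * (2 / c * n) = 2 * n := by field_simp
  rw [e] at hcard
  have hlt : n < F.card := by
    have : (n : ℝ) < F.card := by linarith
    exact_mod_cast this
  refine le_of_eq_of_le ?_ (exp_le_minError ha₀ ha hβ hb hlt hF)
  rw [Real.mul_rpow (by positivity) hn0.le]
  congr 3
  ring

theorem isExpRate_one_div {a₀ β : ℝ} (ha₀ : 0 < a₀) (ha : ∀ j, a₀ ≤ a j) (hβ : 0 < β)
    (hb : ∀ j, β ≤ b j) (ω : Set.Ioo (0 : ℝ) 1) (Λ : InfoClass) :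
    IsExpRate Λ ω a b fun s => 1 / ∑ j ∈ Finset.range s, 1 / b j := by
  have hb' : ∀ j, 0 < b j := fun j => hβ.trans_le (hb j)
  have hdec := decay_pos ω
  obtain ⟨D, hD0, hD⟩ := exists_minError_boxCard_le ha₀ ha hβ hb ω Λ
  refine ⟨fun s hs => one_div_pos.mpr (sum_one_div_pos hb' hs), Real.exp (-(decay ω * a₀ / 4)),
    ⟨Real.exp_pos _, Real.exp_lt_one_iff.mpr (by have := mul_pos hdec ha₀; linarith)⟩,
    fun s => 2 * Real.exp (D * ∑ j ∈ Finset.range s, Real.exp (-(decay ω / 2 * a j))),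
    fun s => 3 ^ s, fun s _ => ⟨by positivity, by positivity⟩, fun s hs n hn => ?_⟩
  have hB := sum_one_div_pos hb' hs
  set B := ∑ j ∈ Finset.range s, 1 / b j with hBdef
  set y : ℝ := ((n : ℝ) / 3 ^ s) ^ (1 / B) with hy
  have hy0 : 0 ≤ y := by positivity
  have hcard : boxCard a b (a₀ * y) s ≤ n := by
    rcases le_or_gt 1 y with h1 | h1
    · have h2 := boxCard_le ha₀ ha hb' (T := a₀ * y) (le_mul_of_one_le_right ha₀.le h1) s
      rw [mul_div_cancel_left₀ _ ha₀.ne', ← hBdef, hy, ← Real.rpow_mul (by positivity),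
        one_div_mul_cancel hB.ne', Real.rpow_one] at h2
      have h3 : (3 : ℝ) ^ ((Finset.range s).filter fun j => a j ≤ a₀ * y).card ≤ 3 ^ s :=
        pow_le_pow_right₀ (by norm_num) ((Finset.card_filter_le _ _).trans (by simp))
      have h4 : (boxCard a b (a₀ * y) s : ℝ) ≤ n := by
        refine h2.trans ((mul_le_mul_of_nonneg_right h3 (by positivity)).trans (le_of_eq ?_))
        field_simp
      exact_mod_cast h4
    · have h2 : ∀ j, side a b (a₀ * y) j = 0 := by
        intro j
        have haj := ha₀.trans_le (ha j)
        refine Nat.floor_eq_zero.mpr (Real.rpow_lt_one (by positivity) ?_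
          (one_div_pos.mpr (hb' j)))
        rw [div_lt_one haj]
        have := ha j
        nlinarith
      simpa [boxCard, h2] using hn
  refine (minError_antitone Λ ω a b s hcard).trans ((hD s (a₀ * y)).trans (le_of_eq ?_))
  rw [← Real.exp_mul, mul_assoc 2, ← Real.exp_add]
  congr 3
  ring

/-- No rate at `s` exceeds `1 / B(s)`. -/
theorem IsExpRate.le {a₀ β : ℝ} (ha₀ : 0 < a₀) (ha : ∀ j, a₀ ≤ a j) (hβ : 0 < β)
    (hb : ∀ j, β ≤ b j) {Λ : InfoClass} {p : ℕ → ℝ} (hp : IsExpRate Λ ω a b p) (hs : 1 ≤ s) :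
    p s ≤ 1 / ∑ j ∈ Finset.range s, 1 / b j := by
  obtain ⟨hp0, q, ⟨hq0, hq1⟩, C, C₁, hC, H⟩ := hp
  obtain ⟨c, hc, hlow⟩ := exists_exp_le_minError ha₀ ha hβ hb ω Λ hs
  have hr0 : 0 < 1 / ∑ j ∈ Finset.range s, 1 / b j :=
    one_div_pos.mpr (sum_one_div_pos (fun j => hβ.trans_le (hb j)) hs)
  set r := 1 / ∑ j ∈ Finset.range s, 1 / b j
  by_contra! hlt
  set κ := -Real.log q / C₁ s ^ p s with hκ
  obtain ⟨hCs, hC₁s⟩ := hC s hs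
  have hκ0 : 0 < κ := div_pos (neg_pos.mpr (Real.log_neg hq0 hq1)) (Real.rpow_pos_of_pos hC₁s _)
  have hineq : ∀ n : ℕ, 1 ≤ n → κ * (n : ℝ) ^ p s ≤ Real.log (C s) + c * (n : ℝ) ^ r := by
    intro n hn
    have h1 := (hlow n hn).trans (H s hs n hn)
    rw [ENNReal.ofReal_le_ofReal_iff (by positivity)] at h1
    have h2 := Real.log_le_log (Real.exp_pos _) h1
    rw [Real.log_exp, Real.log_mul hCs.ne' (Real.rpow_pos_of_pos hq0 _).ne', Real.log_rpow hq0,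
      Real.div_rpow n.cast_nonneg hC₁s.le] at h2
    have h3 : κ * (n : ℝ) ^ p s = -((n : ℝ) ^ p s / C₁ s ^ p s * Real.log q) := by
      rw [hκ]
      ring
    linarith
  have ht1 : Tendsto (fun n : ℕ => (n : ℝ) ^ (p s - r)) atTop atTop :=
    (tendsto_rpow_atTop (sub_pos.mpr hlt)).comp tendsto_natCast_atTop_atTop
  have ht2 : Tendsto (fun n : ℕ => (n : ℝ) ^ r) atTop atTop :=
    (tendsto_rpow_atTop hr0).comp tendsto_natCast_atTop_atTop
  obtain ⟨n, hn1, hn2, hn3⟩ := ((ht1.eventually_ge_atTop ((c + 1) / κ)).and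
    ((ht2.eventually_gt_atTop (Real.log (C s))).and (eventually_ge_atTop 1))).exists
  have hn0 : (0 : ℝ) < n := by exact_mod_cast hn3
  have h1 := hineq n hn3
  have h2 : (n : ℝ) ^ p s = (n : ℝ) ^ (p s - r) * (n : ℝ) ^ r := by
    rw [← Real.rpow_add hn0]
    ring_nf
  rw [div_le_iff₀ hκ0] at hn1
  have h3 : 0 < (n : ℝ) ^ r := Real.rpow_pos_of_pos hn0 r
  rw [h2] at h1
  nlinarith

theorem IsExpRate.const_of_le {Λ : InfoClass} {p : ℕ → ℝ} (hp : IsExpRate Λ ω a b p) {r : ℝ}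
    (hr : 0 < r) (hrp : ∀ s, 1 ≤ s → r ≤ p s) : IsExpRate Λ ω a b fun _ => r := by
  obtain ⟨hp0, q, ⟨hq0, hq1⟩, C, C₁, hC, H⟩ := hp
  refine ⟨fun _ _ => hr, q, ⟨hq0, hq1⟩, fun s => C s / q, C₁,
    fun s hs => ⟨div_pos (hC s hs).1 hq0, (hC s hs).2⟩, fun s hs n hn => ?_⟩
  refine (H s hs n hn).trans (ENNReal.ofReal_le_ofReal ?_)
  have hCs := (hC s hs).1
  set y : ℝ := (n : ℝ) / C₁ s
  have hy : 0 ≤ y := div_nonneg n.cast_nonneg (hC s hs).2.le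
  rw [div_mul_eq_mul_div, mul_div_assoc]
  refine mul_le_mul_of_nonneg_left ?_ hCs.le
  rw [le_div_iff₀ hq0, ← Real.rpow_add_one hq0.ne']
  -- For `y < 1` the shift of the exponent by one absorbs the loss.
  refine Real.rpow_le_rpow_of_exponent_ge hq0 hq1.le ?_
  rcases le_or_gt 1 y with h1 | h1
  · have := Real.rpow_le_rpow_of_exponent_le h1 (hrp s hs)
    linarith
  · have h2 := Real.rpow_le_one hy h1.le hr.le
    have h3 : 0 ≤ y ^ p s := Real.rpow_nonneg hy _
    linarith

theorem isLUB_expRates {a₀ β : ℝ} (ha₀ : 0 < a₀) (ha : ∀ j, a₀ ≤ a j) (hβ : 0 < β)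
    (hb : ∀ j, β ≤ b j) (ω : Set.Ioo (0 : ℝ) 1) (Λ : InfoClass) (hs : 1 ≤ s) :
    IsLUB (expRates Λ ω a b s) (1 / ∑ j ∈ Finset.range s, 1 / b j) := by
  refine IsGreatest.isLUB ⟨⟨_, isExpRate_one_div ha₀ ha hβ hb ω Λ, rfl⟩, ?_⟩
  rintro _ ⟨p, hp, rfl⟩
  exact hp.le ha₀ ha hβ hb hs

/-- Bounds on the partial sums of `1 / b_j` give summability and a bound on the sum. -/
theorem summable_and_tsum_le (hb : ∀ j, 0 < b j) {t : ℝ}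
    (h : ∀ s, 1 ≤ s → ∑ j ∈ Finset.range s, 1 / b j ≤ t) :
    (Summable fun j => 1 / b j) ∧ ∑' j, 1 / b j ≤ t := by
  have h0 : ∀ j, 0 ≤ 1 / b j := fun j => (one_div_pos.mpr (hb j)).le
  have h' : ∀ s, ∑ j ∈ Finset.range s, 1 / b j ≤ t := by
    intro s
    rcases Nat.eq_zero_or_pos s with rfl | hs
    · simpa using (h0 0).trans (by simpa using h 1 le_rfl)
    · exact h s hs
  exact ⟨summable_of_sum_range_le h0 h', Real.tsum_le_of_sum_range_le h0 h'⟩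

theorem summable_of_isExpRate_const {a₀ β : ℝ} (ha₀ : 0 < a₀) (ha : ∀ j, a₀ ≤ a j) (hβ : 0 < β)
    (hb : ∀ j, β ≤ b j) {Λ : InfoClass} {r : ℝ} (hr : IsExpRate Λ ω a b fun _ => r) :
    (Summable fun j => 1 / b j) ∧ ∑' j, 1 / b j ≤ 1 / r := by
  have hb' : ∀ j, 0 < b j := fun j => hβ.trans_le (hb j)
  refine summable_and_tsum_le hb' fun s hs => ?_
  rw [le_one_div (sum_one_div_pos hb' hs) (hr.1 1 le_rfl)]
  exact hr.le ha₀ ha hβ hb hs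

theorem tsum_one_div_pos (hb : ∀ j, 0 < b j) (hB : Summable fun j => 1 / b j) :
    0 < ∑' j, 1 / b j :=
  hB.tsum_pos (fun j => (one_div_pos.mpr (hb j)).le) 0 (one_div_pos.mpr (hb 0))

theorem sum_range_le_tsum_one_div (hb : ∀ j, 0 < b j) (hB : Summable fun j => 1 / b j) (s : ℕ) :
    ∑ j ∈ Finset.range s, 1 / b j ≤ ∑' j, 1 / b j :=
  hB.sum_le_tsum _ fun j _ => (one_div_pos.mpr (hb j)).le

theorem isExpRate_const {a₀ β : ℝ} (ha₀ : 0 < a₀) (ha : ∀ j, a₀ ≤ a j) (hβ : 0 < β)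
    (hb : ∀ j, β ≤ b j) (ω : Set.Ioo (0 : ℝ) 1) (Λ : InfoClass) (hB : Summable fun j => 1 / b j) :
    IsExpRate Λ ω a b fun _ => 1 / ∑' j, 1 / b j := by
  have hb' : ∀ j, 0 < b j := fun j => hβ.trans_le (hb j)
  exact (isExpRate_one_div ha₀ ha hβ hb ω Λ).const_of_le (one_div_pos.mpr (tsum_one_div_pos hb' hB))
    fun s hs => one_div_le_one_div_of_le (sum_one_div_pos hb' hs)
      (sum_range_le_tsum_one_div hb' hB s)

theorem uexp_iff {a₀ β : ℝ} (ha₀ : 0 < a₀) (ha : ∀ j, a₀ ≤ a j) (hβ : 0 < β)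
    (hb : ∀ j, β ≤ b j) (ω : Set.Ioo (0 : ℝ) 1) (Λ : InfoClass) :
    UEXP Λ ω a b ↔ Summable fun j => 1 / b j :=
  ⟨fun ⟨_, hr⟩ => (summable_of_isExpRate_const ha₀ ha hβ hb hr).1,
    fun hB => ⟨_, isExpRate_const ha₀ ha hβ hb ω Λ hB⟩⟩

theorem isLUB_uniformExpRates {a₀ β : ℝ} (ha₀ : 0 < a₀) (ha : ∀ j, a₀ ≤ a j) (hβ : 0 < β)
    (hb : ∀ j, β ≤ b j) (ω : Set.Ioo (0 : ℝ) 1) (Λ : InfoClass) (hB : Summable fun j => 1 / b j) :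
    IsLUB (uniformExpRates Λ ω a b) (1 / ∑' j, 1 / b j) := by
  refine IsGreatest.isLUB ⟨isExpRate_const ha₀ ha hβ hb ω Λ hB, fun r hr => ?_⟩
  rw [le_one_div (hr.1 1 le_rfl) (tsum_one_div_pos (fun j => hβ.trans_le (hb j)) hB)]
  exact (summable_of_isExpRate_const ha₀ ha hβ hb hr).2

/-! ### The information complexity -/

theorem one_le_scale {a₀ β : ℝ} (ha₀ : 0 < a₀) (ha : ∀ j, a₀ ≤ a j) (hβ : 0 < β)
    (hb : ∀ j, β ≤ b j) (ω : Set.Ioo (0 : ℝ) 1) (Λ : InfoClass) (crit : Criterion) (s : ℕ) :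
    1 ≤ crit.scale Λ ω a b s := by
  cases crit
  · exact le_rfl
  · exact one_le_minError_zero ha₀ ha hβ hb ω Λ s

theorem scale_le_minError_zero {a₀ β : ℝ} (ha₀ : 0 < a₀) (ha : ∀ j, a₀ ≤ a j) (hβ : 0 < β)
    (hb : ∀ j, β ≤ b j) (ω : Set.Ioo (0 : ℝ) 1) (Λ : InfoClass) (crit : Criterion) (s : ℕ) :
    crit.scale Λ ω a b s ≤ minError Λ ω a b 0 s := by
  cases crit
  · exact one_le_minError_zero ha₀ ha hβ hb ω Λ s
  · exact le_rfl

theorem infoComplexity_le {a₀ β : ℝ} (ha₀ : 0 < a₀) (ha : ∀ j, a₀ ≤ a j) (hβ : 0 < β)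
    (hb : ∀ j, β ≤ b j) {Λ : InfoClass} (crit : Criterion) {n : ℕ} {ε : ℝ}
    (h : minError Λ ω a b n s ≤ ENNReal.ofReal ε) : infoComplexity Λ crit ω a b ε s ≤ n :=
  Nat.sInf_le (h.trans (le_mul_of_one_le_right' (one_le_scale ha₀ ha hβ hb ω Λ crit s)))

/-- The minimal errors tend to zero, so that the infimum in the information complexity is over a
nonempty set. -/
theorem minError_infoComplexity_le {a₀ β : ℝ} (ha₀ : 0 < a₀) (ha : ∀ j, a₀ ≤ a j) (hβ : 0 < β)
    (hb : ∀ j, β ≤ b j) (Λ : InfoClass) (crit : Criterion) {ε : ℝ} (hε : 0 < ε) :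
    minError Λ ω a b (infoComplexity Λ crit ω a b ε s) s ≤
      ENNReal.ofReal ε * minError Λ ω a b 0 s := by
  have hne : {n : ℕ | minError Λ ω a b n s ≤
      ENNReal.ofReal ε * crit.scale Λ ω a b s}.Nonempty := by
    obtain ⟨D, -, hD⟩ := exists_minError_boxCard_le ha₀ ha hβ hb ω Λ
    set S := D * ∑ j ∈ Finset.range s, Real.exp (-(decay ω / 2 * a j))
    refine ⟨_, (hD s (4 * (S - Real.log (ε / 2)) / decay ω)).trans
      (le_trans (ENNReal.ofReal_le_ofReal ?_)
        (le_mul_of_one_le_right' (one_le_scale ha₀ ha hβ hb ω Λ crit s)))⟩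
    have hdec := (decay_pos ω).ne'
    have e : S - decay ω * (4 * (S - Real.log (ε / 2)) / decay ω) / 4 = Real.log (ε / 2) := by
      field_simp
      ring
    rw [e, Real.exp_log (by positivity)]
    linarith
  have hmem : minError Λ ω a b (infoComplexity Λ crit ω a b ε s) s ≤
      ENNReal.ofReal ε * crit.scale Λ ω a b s := Nat.sInf_mem hne
  exact hmem.trans
    (mul_le_mul_right (scale_le_minError_zero ha₀ ha hβ hb ω Λ crit s) _)

/-- Frequencies of small exponent are counted by the information complexity, under either error
criterion. -/
theorem exists_card_le_infoComplexity {a₀ β : ℝ} (ha₀ : 0 < a₀) (ha : ∀ j, a₀ ≤ a j) (hβ : 0 < β)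
    (hb : ∀ j, β ≤ b j) (ω : Set.Ioo (0 : ℝ) 1) (Λ : InfoClass) (crit : Criterion) :
    ∃ C : ℝ, 0 ≤ C ∧ ∀ (s : ℕ) (T : ℝ) (F : Finset (Fin s → ℤ)), (∀ h ∈ F, exponent a b h ≤ T) →
      ∀ ε : ℝ, 0 < ε → C * s + decay ω * T / 2 < Real.log ε⁻¹ →
        F.card ≤ infoComplexity Λ crit ω a b ε s := by
  obtain ⟨C, hC0, hC⟩ := exists_minError_zero_le ha₀ ha hβ hb ω Λ
  refine ⟨C, hC0, fun s T F hF ε hε hlt => ?_⟩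
  by_contra! hcard
  have h1 := (exp_le_minError ha₀ ha hβ hb hcard hF).trans
    ((minError_infoComplexity_le ha₀ ha hβ hb Λ crit hε).trans (mul_le_mul_right (hC s) _))
  rw [← ENNReal.ofReal_mul hε.le, ENNReal.ofReal_le_ofReal_iff (by positivity),
    ← Real.exp_log hε, ← Real.exp_add, Real.exp_le_exp] at h1
  rw [Real.log_inv] at hlt
  linarith

/-! ### Weak tractability -/

theorem exponent_le_of_mem_zero_one (ha : ∀ j, 0 < a j) (hb : ∀ j, 0 < b j) (ha_mono : Monotone a)
    {h : Fin s → ℤ} (hh : h ∈ Fintype.piFinset fun _ : Fin s => ({0, 1} : Finset ℤ)) :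
    exponent a b h ≤ s * a (s - 1) := by
  have h1 : ∀ j : Fin s, a j * |(h j : ℝ)| ^ b j ≤ a (s - 1) := by
    intro j
    have h2 : a j ≤ a (s - 1) := ha_mono (by have := j.2; omega)
    have h3 := Fintype.mem_piFinset.mp hh j
    simp only [Finset.mem_insert, Finset.mem_singleton] at h3
    rcases h3 with h3 | h3 <;> rw [h3]
    · simp [Real.zero_rpow (hb j).ne', (ha _).le]
    · simpa using h2
  refine (Finset.sum_le_sum fun j _ => h1 j).trans (le_of_eq ?_)
  simp

/-- If `a` stays bounded, the squared initial error grows exponentially in `s`. Since no weight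
exceeds one, each information evaluation lowers the squared error by at most one. -/
theorem pow_le_infoComplexity {a₀ β M : ℝ} (ha₀ : 0 < a₀) (ha : ∀ j, a₀ ≤ a j) (hβ : 0 < β)
    (hb : ∀ j, β ≤ b j) (hM : ∀ j, a j ≤ M) (ω : Set.Ioo (0 : ℝ) 1) (Λ : InfoClass)
    (crit : Criterion) (s : ℕ) :
    3 / 4 * (1 + Real.exp (-(decay ω * M))) ^ s ≤
      (infoComplexity Λ crit ω a b (1 / 2) s : ℝ) := by
  have hS : Summable fun h : Fin s → ℤ => weight ω a b h := summable_weight ha₀ ha hβ hb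
  set K := ∑' h : Fin s → ℤ, weight ω a b h with hK
  have hK0 : 0 ≤ K := tsum_nonneg fun h => (weight_pos ω a b h).le
  have hle : ∀ G : Finset (Fin s → ℤ), ∑ h ∈ G, weight ω a b h ≤ K := fun G =>
    hS.sum_le_tsum _ fun h _ => (weight_pos ω a b h).le
  have h0 : minError Λ ω a b 0 s ≤ ENNReal.ofReal (√K) :=
    minError_zero_le Λ (weight_pos ω a b) hS (Real.sqrt_nonneg _) fun G => by
      rw [Real.sq_sqrt hK0]
      exact hle G
  have h1 := (minError_infoComplexity_le (s := s) (ω := ω) ha₀ ha hβ hb Λ crit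
    (one_half_pos (α := ℝ))).trans (mul_le_mul_right h0 _)
  rw [← ENNReal.ofReal_mul (by norm_num)] at h1
  have h2 : K ≤ (1 / 2 * √K) ^ 2 + (infoComplexity Λ crit ω a b (1 / 2) s : ℝ) :=
    hS.tsum_le_of_sum_le fun F => sum_weight_le_of_minError_le (weight_pos ω a b)
      (weight_le_one ω fun j => ha₀.trans_le (ha j)) hS (by positivity) h1 F
  rw [mul_pow, Real.sq_sqrt hK0] at h2
  have h3 : (1 + Real.exp (-(decay ω * M))) ^ s ≤ K := by
    refine le_trans ?_ (hle (Fintype.piFinset fun _ => {0, 1}))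
    have e : ∑ h ∈ Fintype.piFinset (fun _ : Fin s => ({0, 1} : Finset ℤ)), weight ω a b h =
        ∏ j : Fin s, (1 + Real.exp (-(decay ω * a j))) := by
      have h4 : ∀ j : Fin s, 1 + Real.exp (-(decay ω * a j)) =
          ∑ k ∈ ({0, 1} : Finset ℤ), Real.exp (-(decay ω * (a j * |(k : ℝ)| ^ b j))) := by
        intro j
        rw [Finset.sum_insert (by simp), Finset.sum_singleton]
        simp [Real.zero_rpow (hβ.trans_le (hb j)).ne']
      rw [Finset.prod_congr rfl fun j _ => h4 j, Finset.prod_univ_sum]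
      refine Finset.sum_congr rfl fun h _ => ?_
      rw [weight_eq_exp, ← Real.exp_sum, exponent, Finset.mul_sum, Finset.sum_neg_distrib]
    rw [e]
    calc (1 + Real.exp (-(decay ω * M))) ^ s
        = ∏ _j : Fin s, (1 + Real.exp (-(decay ω * M))) := by simp
      _ ≤ _ := by
        refine Finset.prod_le_prod (fun _ _ => by positivity) fun j _ => ?_
        have := mul_le_mul_of_nonneg_left (hM j) (decay_pos ω).le
        gcongr
  linarith

theorem tendsto_of_kappaECWT {a₀ β : ℝ} (ha₀ : 0 < a₀) (ha : ∀ j, a₀ ≤ a j) (hβ : 0 < β)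
    (hb : ∀ j, β ≤ b j) (ha_mono : Monotone a) {Λ : InfoClass} {crit : Criterion} {κ : ℝ}
    (h : KappaECWT Λ crit ω a b κ) : Tendsto a atTop atTop := by
  refine tendsto_atTop_atTop_of_monotone ha_mono fun M => ?_
  by_contra! hM
  set θ := Real.exp (-(decay ω * M))
  have hθ : 0 < Real.log (1 + θ) := Real.log_pos (by linarith [Real.exp_pos (-(decay ω * M))])
  have hpath : Tendsto (fun s : ℕ => ((s, 1 / 2) : ℕ × ℝ)) atTop ecFilter := by
    refine tendsto_inf.mpr ⟨tendsto_comap_iff.mpr ?_, tendsto_principal.mpr ?_⟩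
    · have ht : Tendsto (fun s : ℕ => (s : ℝ) + Real.log (1 / 2 : ℝ)⁻¹) atTop atTop :=
        tendsto_atTop_add_const_right _ _ tendsto_natCast_atTop_atTop
      exact ht
    · filter_upwards [eventually_ge_atTop 1] with s hs
      exact ⟨hs, by norm_num⟩
  have h1 := (h.comp hpath).eventually_lt_const (half_pos hθ)
  have h2 : Tendsto (fun s : ℕ => (s : ℝ)) atTop atTop := tendsto_natCast_atTop_atTop
  set c := Real.log (1 / 2 : ℝ)⁻¹ ^ κ with hc
  have hc0 : 0 ≤ c := Real.rpow_nonneg (Real.log_nonneg (by norm_num)) _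
  obtain ⟨s, hs1, hs2, hs3⟩ := (h1.and ((h2.eventually_gt_atTop
    ((Real.log (1 + θ) / 2 * c - Real.log (3 / 4)) / (Real.log (1 + θ) / 2))).and
    (h2.eventually_gt_atTop 0))).exists
  simp only [Function.comp] at hs1
  rw [← hc, div_lt_iff₀ (by positivity)] at hs1
  rw [div_lt_iff₀ (half_pos hθ)] at hs2
  have h3 := Real.log_le_log (by positivity)
    (pow_le_infoComplexity ha₀ ha hβ hb (fun j => (hM j).le) ω Λ crit s)
  rw [Real.log_mul (by norm_num) (by positivity), Real.log_pow] at h3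
  nlinarith

theorem exists_log_one_add_le {θ : ℝ} (hθ : 0 < θ) :
    ∃ C : ℝ, ∀ y : ℝ, 0 ≤ y → Real.log (1 + y) ≤ θ * y + C := by
  refine ⟨θ - 1 - Real.log θ, fun y hy => ?_⟩
  have h := Real.log_le_sub_one_of_pos (x := θ * (1 + y)) (by positivity)
  rw [Real.log_mul hθ.ne' (by positivity)] at h
  linarith

theorem exists_sum_range_le {f : ℕ → ℝ} (hf0 : ∀ j, 0 ≤ f j) (hf : Tendsto f atTop (𝓝 0)) {θ : ℝ}
    (hθ : 0 < θ) : ∃ C : ℝ, ∀ s : ℕ, ∑ j ∈ Finset.range s, f j ≤ θ * s + C := by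
  obtain ⟨J, hJ⟩ := eventually_atTop.mp (hf.eventually_lt_const hθ)
  refine ⟨∑ j ∈ Finset.range J, f j, fun s => ?_⟩
  calc ∑ j ∈ Finset.range s, f j
      ≤ ∑ j ∈ Finset.range s, (θ + if j < J then f j else 0) := by
        refine Finset.sum_le_sum fun j _ => ?_
        split_ifs with h
        · linarith
        · linarith [hJ j (not_lt.mp h)]
    _ = θ * s + ∑ j ∈ (Finset.range s).filter (· < J), f j := by
        rw [Finset.sum_add_distrib, Finset.sum_filter]
        simp [mul_comm]
    _ ≤ θ * s + ∑ j ∈ Finset.range J, f j := by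
        gcongr
        · exact fun j _ _ => hf0 j
        · intro j hj
          exact Finset.mem_range.mpr (Finset.mem_filter.mp hj).2

theorem tendsto_exp_neg_mul (ha : Tendsto a atTop atTop) {c : ℝ} (hc : 0 < c) :
    Tendsto (fun j => Real.exp (-(c * a j))) atTop (𝓝 0) :=
  Real.tendsto_exp_neg_atTop_nhds_zero.comp (ha.const_mul_atTop hc)

/-- If there are at most `exp Q` frequencies of exponent at most `T`, a lattice with a prime number
of points, polynomially large in `exp Q`, `s` and `T`, separates them. -/
theorem exists_separates_log_le {a₀ β : ℝ} (ha₀ : 0 < a₀) (ha : ∀ j, a₀ ≤ a j) (hβ : 0 < β)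
    (hb : ∀ j, β ≤ b j) (hs : 1 ≤ s) {T Q : ℝ} (hT0 : 0 ≤ T) (hQ0 : 0 ≤ Q)
    (hcard : ∀ F : Finset (Fin s → ℤ), (∀ h ∈ F, exponent a b h ≤ T) → (F.card : ℝ) ≤ Real.exp Q) :
    ∃ (F : Finset (Fin s → ℤ)) (P : ℕ) (g : Fin s → ℤ), 0 < P ∧ Separates P g F ∧
      (∀ h, exponent a b h ≤ T → h ∈ F) ∧
      Real.log P ≤ Real.log 8 + 2 * Q + Real.log s + 1 / β * Real.log (1 + T / a₀) := by
  classical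
  have hapos : ∀ j, 0 < a j := fun j => ha₀.trans_le (ha j)
  have hbpos : ∀ j, 0 < b j := fun j => hβ.trans_le (hb j)
  have hs1 : (1 : ℝ) ≤ s := by exact_mod_cast hs
  let F : Finset (Fin s → ℤ) := (Fintype.piFinset fun j : Fin s =>
    Finset.Icc (-(side a b T j : ℤ)) (side a b T j)).filter fun h => exponent a b h ≤ T
  have hF : ∀ h : Fin s → ℤ, h ∈ F ↔ exponent a b h ≤ T := by
    intro h
    simp only [F, Finset.mem_filter, Fintype.mem_piFinset, Finset.mem_Icc, ← abs_le,
      and_iff_right_iff_imp]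
    exact fun hle => abs_le_side hapos hbpos hle
  have hN := hcard F fun h => (hF h).mp
  set H : ℝ := (1 + T / a₀) ^ (1 / β) with hH
  have hbase : 1 ≤ 1 + T / a₀ := by
    have : 0 ≤ T / a₀ := by positivity
    linarith
  have hH1 : 1 ≤ H := Real.one_le_rpow hbase (by positivity)
  have hside : ∀ j, side a b T j ≤ ⌊H⌋₊ := by
    intro j
    refine Nat.floor_le_floor ?_
    have haj := hapos j
    calc (T / a j) ^ (1 / b j) ≤ (1 + T / a₀) ^ (1 / b j) := by
          have h1 : T / a j ≤ T / a₀ := div_le_div_of_nonneg_left hT0 ha₀ (ha j)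
          exact Real.rpow_le_rpow (by positivity) (by linarith)
            (one_div_pos.mpr (hbpos j)).le
      _ ≤ H := Real.rpow_le_rpow_of_exponent_le hbase (one_div_le_one_div_of_le hβ (hb j))
  obtain ⟨P, hP, hlt, hle⟩ := Nat.exists_prime_lt_and_le_two_mul
    (F.card * F.card * s + 2 * ⌊H⌋₊ + 1) (by omega)
  obtain ⟨g, hg⟩ := exists_separates_prime F hP (by omega) (by
    intro h hh j
    have h1 := abs_le_side hapos hbpos ((hF h).mp hh) j
    have h2 := hside j
    omega)
  refine ⟨F, P, g, hP.pos, hg, fun h => (hF h).mpr, ?_⟩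
  have hPle : (P : ℝ) ≤ 8 * Real.exp Q ^ 2 * s * H := by
    have h1 : (P : ℝ) ≤
        2 * ((F.card : ℝ) * F.card * s + 2 * (⌊H⌋₊ : ℝ) + 1) := by
      exact_mod_cast hle
    have h2 : (⌊H⌋₊ : ℝ) ≤ H := Nat.floor_le (by positivity)
    have h3 : (F.card : ℝ) * F.card ≤ Real.exp Q ^ 2 := by
      rw [sq]
      gcongr
    have h4 : 1 ≤ Real.exp Q ^ 2 := one_le_pow₀ (Real.one_le_exp hQ0)
    have h5 : 1 ≤ Real.exp Q ^ 2 * s := one_le_mul_of_one_le_of_one_le h4 hs1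
    have h6 : (F.card : ℝ) * F.card * s ≤ Real.exp Q ^ 2 * s * H :=
      (mul_le_mul_of_nonneg_right h3 (by positivity)).trans
        (le_mul_of_one_le_right (by positivity) hH1)
    have h7 : H ≤ Real.exp Q ^ 2 * s * H := le_mul_of_one_le_left (by positivity) h5
    linarith
  have hs0 : (0 : ℝ) < s := by linarith
  have hH0 : 0 < H := by linarith
  have h0 : Real.log (8 * Real.exp Q ^ 2 * s * H) =
      Real.log 8 + 2 * Q + Real.log s + 1 / β * Real.log (1 + T / a₀) := by
    rw [Real.log_mul (by positivity) hH0.ne', Real.log_mul (by positivity) hs0.ne',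
      Real.log_mul (by norm_num) (by positivity), Real.log_pow, Real.log_exp, hH,
      Real.log_rpow (by linarith)]
    push_cast
    ring
  rw [← h0]
  exact Real.log_le_log (by exact_mod_cast hP.pos) hPle

/-- The number of frequencies of exponent at most `T` grows subexponentially in `s + T` if `a` tends
to infinity. -/
theorem exists_log_infoComplexity_le {a₀ β : ℝ} (ha₀ : 0 < a₀) (ha : ∀ j, a₀ ≤ a j) (hβ : 0 < β)
    (hb : ∀ j, β ≤ b j) (hlim : Tendsto a atTop atTop) (ω : Set.Ioo (0 : ℝ) 1) (Λ : InfoClass)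
    (crit : Criterion) {δ : ℝ} (hδ : 0 < δ) :
    ∃ C : ℝ, ∀ s : ℕ, 1 ≤ s → ∀ ε ∈ Set.Ioo (0 : ℝ) 1,
      Real.log (infoComplexity Λ crit ω a b ε s : ℝ) ≤ δ * (s + Real.log ε⁻¹) + C := by
  have hd := decay_pos ω
  have hapos : ∀ j, 0 < a j := fun j => ha₀.trans_le (ha j)
  have hbpos : ∀ j, 0 < b j := fun j => hβ.trans_le (hb j)
  obtain ⟨D, hD0, hD⟩ := exists_minError_le_of_separates ha₀ ha hβ hb ω Λ
  set K := 4 * (1 + D) / decay ω with hKdef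
  have hK : 0 < K := by positivity
  set η := δ / (8 * K) with hηdef
  have hη : 0 < η := by positivity
  obtain ⟨D', hD'0, hD'⟩ := exists_sum_exp_exponent_le ha₀ ha hβ hb hη
  obtain ⟨C₁, hC₁⟩ := exists_sum_range_le (fun j => (Real.exp_pos (-(η * a j))).le)
    (tendsto_exp_neg_mul hlim hη) (θ := δ / (8 * (D' + 1))) (by positivity)
  obtain ⟨C₂, hC₂⟩ := exists_log_one_add_le (θ := δ / 4) (by positivity)
  obtain ⟨C₃, hC₃⟩ := exists_log_one_add_le (θ := δ * β * a₀ / (4 * K)) (by positivity)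
  refine ⟨Real.log 8 + 2 * (D' * C₁) + C₂ + 1 / β * C₃, fun s hs ε hε => ?_⟩
  set x := Real.log ε⁻¹ with hx
  have hx0 : 0 < x := Real.log_pos ((one_lt_inv₀ hε.1).mpr hε.2)
  have hs1 : (1 : ℝ) ≤ s := by exact_mod_cast hs
  set A := ∑ j ∈ Finset.range s, Real.exp (-(decay ω / 2 * a j)) with hA
  have hA0 : 0 ≤ A := Finset.sum_nonneg fun _ _ => (Real.exp_pos _).le
  have hAs : A ≤ s := by
    refine (Finset.sum_le_card_nsmul _ _ 1 fun j _ => ?_).trans (by simp)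
    rw [Real.exp_le_one_iff, neg_nonpos]
    exact mul_nonneg (half_pos hd).le (hapos j).le
  set T := 4 * (x + Real.log 2 + D * A) / decay ω with hT
  have hlog2 : 0 < Real.log 2 := Real.log_pos one_lt_two
  have hlog2' : Real.log 2 ≤ 1 := by
    have := Real.log_le_sub_one_of_pos (x := 2) two_pos
    linarith
  have hT0 : 0 ≤ T := by positivity
  have hTK : T ≤ K * (s + x) := by
    rw [hT, hKdef, div_mul_eq_mul_div]
    gcongr ?_ / _
    have h1 : D * A ≤ D * s := mul_le_mul_of_nonneg_left hAs hD0
    have h2 : 0 ≤ D * x := by positivity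
    nlinarith
  set Q := η * T + D' * ∑ j ∈ Finset.range s, Real.exp (-(η * a j)) with hQ
  have hQ0 : 0 ≤ Q := add_nonneg (by positivity)
    (mul_nonneg hD'0 (Finset.sum_nonneg fun _ _ => (Real.exp_pos _).le))
  have hN : ∀ F : Finset (Fin s → ℤ), (∀ h ∈ F, exponent a b h ≤ T) →
      (F.card : ℝ) ≤ Real.exp Q := by
    intro F hF
    have h1 : (F.card : ℝ) * Real.exp (-(η * T)) ≤ ∑ h ∈ F, Real.exp (-(η * exponent a b h)) := by
      rw [← nsmul_eq_mul]
      refine Finset.card_nsmul_le_sum _ _ _ fun h hh => ?_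
      have := mul_le_mul_of_nonneg_left (hF h hh) hη.le
      exact Real.exp_le_exp.mpr (by linarith)
    have h2 := h1.trans (hD' s F)
    rw [Real.exp_neg, mul_inv_le_iff₀ (Real.exp_pos _), ← Real.exp_add] at h2
    rwa [hQ, add_comm]
  obtain ⟨F, P, g, hP, hg, hF, hlogP⟩ := exists_separates_log_le ha₀ ha hβ hb hs hT0 hQ0 hN
  have hn : infoComplexity Λ crit ω a b ε s ≤ P := by
    refine infoComplexity_le ha₀ ha hβ hb crit ((hD s T F P g hP hg hF).trans
      (ENNReal.ofReal_le_ofReal (le_of_eq ?_)))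
    have h1 : D * A - decay ω * T / 4 = -x + -Real.log 2 := by
      rw [hT]
      field_simp
      ring
    rw [h1, Real.exp_add, Real.exp_neg (Real.log 2), Real.exp_log two_pos, hx, Real.log_inv,
      neg_neg, Real.exp_log hε.1]
    ring
  have hlog : Real.log (infoComplexity Λ crit ω a b ε s : ℝ) ≤ Real.log P := by
    rcases Nat.eq_zero_or_pos (infoComplexity Λ crit ω a b ε s) with hz | hpos
    · rw [hz, Nat.cast_zero, Real.log_zero]
      exact Real.log_natCast_nonneg P
    · exact Real.log_le_log (by exact_mod_cast hpos) (by exact_mod_cast hn)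
  -- each of the four terms takes up a quarter of `δ * (s + x)`
  have hq1 : 2 * (η * T) ≤ δ / 4 * (s + x) := by
    have h1 := mul_le_mul_of_nonneg_left hTK hη.le
    have h2 : η * (K * (s + x)) = δ / 8 * (s + x) := by
      rw [hηdef]
      field_simp
    linarith
  have hq2 : D' * ∑ j ∈ Finset.range s, Real.exp (-(η * a j)) ≤ δ / 8 * s + D' * C₁ := by
    refine (mul_le_mul_of_nonneg_left (hC₁ s) hD'0).trans ?_
    have h1 : D' * (δ / (8 * (D' + 1)) * s) ≤ δ / 8 * s := by
      rw [← mul_assoc]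
      refine mul_le_mul_of_nonneg_right ?_ (by positivity)
      rw [mul_div_assoc', div_le_iff₀ (by positivity)]
      nlinarith
    linarith
  have hq3 : Real.log s ≤ δ / 4 * s + C₂ :=
    (Real.log_le_log (by positivity) (by linarith)).trans (hC₂ s (by positivity))
  have hq4 : 1 / β * Real.log (1 + T / a₀) ≤ δ / 4 * (s + x) + 1 / β * C₃ := by
    refine (mul_le_mul_of_nonneg_left (hC₃ (T / a₀) (by positivity)) (by positivity)).trans ?_
    have h1 : 1 / β * (δ * β * a₀ / (4 * K) * (T / a₀)) = δ / 4 * (T / K) := by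
      field_simp
    have h2 : T / K ≤ s + x := by
      rw [div_le_iff₀ hK]
      linarith
    rw [mul_add, h1]
    have := mul_le_mul_of_nonneg_left h2 (show 0 ≤ δ / 4 by positivity)
    linarith
  have hsx : δ / 4 * s ≤ δ / 4 * (s + x) := by
    have : 0 < δ * x := by positivity
    linarith
  rw [hQ] at hlogP
  linarith

theorem kappaECWT_of_tendsto {a₀ β : ℝ} (ha₀ : 0 < a₀) (ha : ∀ j, a₀ ≤ a j) (hβ : 0 < β)
    (hb : ∀ j, β ≤ b j) (hlim : Tendsto a atTop atTop) (ω : Set.Ioo (0 : ℝ) 1) (Λ : InfoClass)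
    (crit : Criterion) {κ : ℝ} (hκ : 1 ≤ κ) : KappaECWT Λ crit ω a b κ := by
  refine Metric.tendsto_nhds.mpr fun δ hδ => ?_
  obtain ⟨C, hC⟩ := exists_log_infoComplexity_le ha₀ ha hβ hb hlim ω Λ crit
    (δ := δ / 8) (by positivity)
  have h1 : ∀ᶠ t in ecFilter, max 1 (8 * C / δ) ≤ (t.1 : ℝ) + Real.log t.2⁻¹ :=
    (tendsto_comap.mono_left inf_le_left).eventually_ge_atTop _
  have h2 : ∀ᶠ t in ecFilter, 1 ≤ t.1 ∧ t.2 ∈ Set.Ioo (0 : ℝ) 1 :=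
    mem_inf_of_right (mem_principal_self _)
  filter_upwards [h1, h2] with t ht1 ht2
  obtain ⟨s, ε⟩ := t
  obtain ⟨hs, hε⟩ := ht2
  simp only at ht1 hs hε ⊢
  have hle := hC s hs ε hε
  set x := Real.log ε⁻¹
  have hx0 : 0 < x := Real.log_pos ((one_lt_inv₀ hε.1).mpr hε.2)
  have hs1 : (1 : ℝ) ≤ s := by exact_mod_cast hs
  have hxκ : ((s : ℝ) + x) / 2 ≤ s + x ^ κ := by
    rcases le_or_gt 1 x with h | h
    · have := Real.rpow_le_rpow_of_exponent_le h hκ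
      rw [Real.rpow_one] at this
      linarith
    · have := Real.rpow_nonneg hx0.le κ
      linarith
  have hC' : C ≤ δ / 8 * (s + x) := by
    have := (le_max_right _ _).trans ht1
    rw [div_le_iff₀ hδ] at this
    linarith
  have hpos : 0 < (s : ℝ) + x ^ κ := by positivity
  rw [Real.dist_eq, sub_zero, abs_of_nonneg (div_nonneg (Real.log_natCast_nonneg _) hpos.le),
    div_lt_iff₀ hpos]
  have : 0 < δ * (s + x) := by positivity
  nlinarith

/-! ### Polynomial and strong polynomial tractability -/

/-- For fixed `s` the information complexity is not `O ((log ε⁻¹) ^ τ)` with `τ < B(s)`. -/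
theorem sum_one_div_le_of_infoComplexity_le {a₀ β : ℝ} (ha₀ : 0 < a₀) (ha : ∀ j, a₀ ≤ a j)
    (hβ : 0 < β) (hb : ∀ j, β ≤ b j) {Λ : InfoClass} {crit : Criterion} (hs : 1 ≤ s) {C τ : ℝ}
    (hC : 0 ≤ C) (hτ : 0 ≤ τ) (h : ∀ ε ∈ Set.Ioo (0 : ℝ) 1,
      (infoComplexity Λ crit ω a b ε s : ℝ) ≤ C * (1 + Real.log ε⁻¹) ^ τ) :
    ∑ j ∈ Finset.range s, 1 / b j ≤ τ := by
  have hd := decay_pos ω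
  obtain ⟨c, hc, H⟩ := exists_le_card (fun j => ha₀.trans_le (ha j))
    (fun j => hβ.trans_le (hb j)) hs
  obtain ⟨C₀, hC₀, hcount⟩ := exists_card_le_infoComplexity ha₀ ha hβ hb ω Λ crit
  set B := ∑ j ∈ Finset.range s, 1 / b j
  by_contra! hlt
  set M := C₀ * s + decay ω / 2 + 2 with hMdef
  have hM : 0 < M := by positivity
  have hineq : ∀ T : ℝ, 1 ≤ T → c * T ^ B ≤ C * M ^ τ * T ^ τ := by
    intro T hT
    have hT0 : 0 < T := by linarith
    obtain ⟨F, hF, hcard⟩ := H T hT0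
    set y := C₀ * s + decay ω * T / 2 + 1 with hy
    have hy0 : 0 < y := by positivity
    have hlog : Real.log (Real.exp (-y))⁻¹ = y := by rw [← Real.exp_neg, neg_neg, Real.log_exp]
    have h1 := hcount s T F hF (Real.exp (-y)) (Real.exp_pos _) (by rw [hlog, hy]; linarith)
    have h2 := h (Real.exp (-y)) ⟨Real.exp_pos _, Real.exp_lt_one_iff.mpr (by linarith)⟩
    rw [hlog] at h2
    have h3 : 1 + y ≤ M * T := by
      have : 0 ≤ C₀ * s := by positivity
      rw [hy, hMdef]
      nlinarith
    calc c * T ^ B ≤ F.card := hcard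
      _ ≤ infoComplexity Λ crit ω a b (Real.exp (-y)) s := by exact_mod_cast h1
      _ ≤ C * (1 + y) ^ τ := h2
      _ ≤ C * (M * T) ^ τ := by gcongr
      _ = C * M ^ τ * T ^ τ := by rw [Real.mul_rpow hM.le hT0.le, mul_assoc]
  obtain ⟨T, hT1, hT2⟩ := (((tendsto_rpow_atTop (sub_pos.mpr hlt)).eventually_gt_atTop
    (C * M ^ τ / c)).and (eventually_ge_atTop 1)).exists
  have hT0 : 0 < T := by linarith
  have h1 := hineq T hT2
  have h2 : T ^ B = T ^ (B - τ) * T ^ τ := by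
    rw [← Real.rpow_add hT0]
    ring_nf
  rw [h2, ← mul_assoc] at h1
  have h3 := le_of_mul_le_mul_right h1 (Real.rpow_pos_of_pos hT0 τ)
  rw [div_lt_iff₀ hc] at hT1
  linarith

theorem summable_of_ecpt {a₀ β : ℝ} (ha₀ : 0 < a₀) (ha : ∀ j, a₀ ≤ a j) (hβ : 0 < β)
    (hb : ∀ j, β ≤ b j) {Λ : InfoClass} {crit : Criterion} (h : ECPT Λ crit ω a b) :
    Summable fun j => 1 / b j := by
  obtain ⟨c, τ₁, τ₂, hc, -, hτ₂, H⟩ := h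
  exact (summable_and_tsum_le (fun j => hβ.trans_le (hb j)) fun s hs =>
    sum_one_div_le_of_infoComplexity_le ha₀ ha hβ hb hs (by positivity) hτ₂ (H s hs)).1

theorem tsum_le_of_mem_sptExponents {a₀ β : ℝ} (ha₀ : 0 < a₀) (ha : ∀ j, a₀ ≤ a j) (hβ : 0 < β)
    (hb : ∀ j, β ≤ b j) {Λ : InfoClass} {crit : Criterion} {τ : ℝ}
    (h : τ ∈ sptExponents Λ crit ω a b) : ∑' j, 1 / b j ≤ τ := by
  obtain ⟨hτ, c, hc, H⟩ := h
  exact (summable_and_tsum_le (fun j => hβ.trans_le (hb j)) fun s hs =>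
    sum_one_div_le_of_infoComplexity_le ha₀ ha hβ hb hs hc hτ (H s hs)).2

/-- All `2 ^ s` frequencies with components zero and one have exponent at most `s a_s`. Under
polynomial tractability this forces `a` to grow exponentially. -/
theorem alphaStar_pos_of_ecpt {a₀ β : ℝ} (ha₀ : 0 < a₀) (ha : ∀ j, a₀ ≤ a j) (hβ : 0 < β)
    (hb : ∀ j, β ≤ b j) (ha_mono : Monotone a) {Λ : InfoClass} {crit : Criterion}
    (h : ECPT Λ crit ω a b) : 0 < alphaStar a := by
  have hd := decay_pos ω
  have hapos : ∀ j, 0 < a j := fun j => ha₀.trans_le (ha j)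
  obtain ⟨c, τ₁, τ₂, hc, hτ₁, hτ₂, H⟩ := h
  obtain ⟨C₀, hC₀, hcount⟩ := exists_card_le_infoComplexity ha₀ ha hβ hb ω Λ crit
  set K := C₀ / a₀ + decay ω / 2 + 2 / a₀ with hK
  have hK0 : 0 < K := by positivity
  have hlog2 : 0 < Real.log 2 := Real.log_pos one_lt_two
  set τ := τ₂ + 1
  have hτ : 0 < τ := by positivity
  have key : ∀ j : ℕ, ((j : ℝ) + 1) * Real.log 2 ≤ Real.log (c + 1) + τ₁ * Real.log (j + 1) +
      τ * (Real.log K + Real.log (j + 1) + Real.log (a j)) := by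
    intro j
    have haj := hapos j
    have hj1 : (1 : ℝ) ≤ (j : ℝ) + 1 := by
      have : (0 : ℝ) ≤ j := j.cast_nonneg
      linarith
    have hj0 : (0 : ℝ) < (j : ℝ) + 1 := by linarith
    have hcard : (Fintype.piFinset fun _ : Fin (j + 1) => ({0, 1} : Finset ℤ)).card =
        2 ^ (j + 1) := by simp [Fintype.card_piFinset]
    have hF : ∀ h ∈ Fintype.piFinset fun _ : Fin (j + 1) => ({0, 1} : Finset ℤ),
        exponent a b h ≤ ((j + 1 : ℕ) : ℝ) * a j := fun h hh => by
      simpa using exponent_le_of_mem_zero_one hapos (fun j => hβ.trans_le (hb j)) ha_mono hh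
    set y := C₀ * ((j + 1 : ℕ) : ℝ) + decay ω * (((j + 1 : ℕ) : ℝ) * a j) / 2 + 1 with hy
    have hy0 : 0 < y := by positivity
    have hlog : Real.log (Real.exp (-y))⁻¹ = y := by rw [← Real.exp_neg, neg_neg, Real.log_exp]
    have h1 := hcount (j + 1) _ _ hF (Real.exp (-y)) (Real.exp_pos _) (by rw [hlog, hy]; linarith)
    have h2 := H (j + 1) (by omega) (Real.exp (-y))
      ⟨Real.exp_pos _, Real.exp_lt_one_iff.mpr (by linarith)⟩
    rw [hlog] at h2
    rw [hcard] at h1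
    have h3 : 1 + y ≤ K * (j + 1) * a j := by
      have e1 : C₀ * ((j : ℝ) + 1) ≤ C₀ / a₀ * (j + 1) * a j := by
        rw [div_mul_eq_mul_div, div_mul_eq_mul_div, le_div_iff₀ ha₀]
        exact mul_le_mul_of_nonneg_left (ha j) (by positivity)
      have e2 : (2 : ℝ) ≤ 2 / a₀ * (j + 1) * a j := by
        rw [div_mul_eq_mul_div, div_mul_eq_mul_div, le_div_iff₀ ha₀]
        have := ha j
        nlinarith
      rw [hy, hK]
      push_cast
      linarith
    have h4 : (2 : ℝ) ^ (j + 1) ≤ (c + 1) * ((j : ℝ) + 1) ^ τ₁ * (K * (j + 1) * a j) ^ τ := by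
      calc (2 : ℝ) ^ (j + 1) ≤ infoComplexity Λ crit ω a b (Real.exp (-y)) (j + 1) := by
            exact_mod_cast h1
        _ ≤ c * ((j + 1 : ℕ) : ℝ) ^ τ₁ * (1 + y) ^ τ₂ := h2
        _ ≤ (c + 1) * ((j : ℝ) + 1) ^ τ₁ * (1 + y) ^ τ := by
            push_cast
            gcongr
            · linarith
            · linarith
            · simp [τ]
        _ ≤ _ := by gcongr
    have h5 := Real.log_le_log (by positivity) h4
    rw [Real.log_pow, Real.log_mul (by positivity) (by positivity),
      Real.log_mul (by positivity) (by positivity), Real.log_rpow hj0,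
      Real.log_rpow (by positivity), Real.log_mul (by positivity) (by positivity),
      Real.log_mul (by positivity) (by positivity)] at h5
    push_cast at h5
    linarith
  obtain ⟨C₁, hC₁⟩ := exists_log_one_add_le (θ := Real.log 2 / (4 * (τ₁ + τ))) (by positivity)
  set γ := Real.log 2 / (4 * τ) with hγ
  have hγ0 : 0 < γ := by positivity
  have hev : ∀ᶠ j : ℕ in atTop, γ ≤ Real.log (a j) / ((j : ℝ) + 1) := by
    have ht : Tendsto (fun j : ℕ => (j : ℝ)) atTop atTop := tendsto_natCast_atTop_atTop
    filter_upwards [ht.eventually_ge_atTop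
      ((Real.log (c + 1) + τ * Real.log K + (τ₁ + τ) * C₁) / (Real.log 2 / 2))] with j hj
    rw [div_le_iff₀ (by positivity)] at hj
    have hj0 : (0 : ℝ) ≤ j := j.cast_nonneg
    rw [le_div_iff₀ (by positivity)]
    have h1 := key j
    have h2 := mul_le_mul_of_nonneg_left (hC₁ j hj0) (show 0 ≤ τ₁ + τ by positivity)
    have h3 : (τ₁ + τ) * (Real.log 2 / (4 * (τ₁ + τ)) * j) = Real.log 2 / 4 * j := by
      field_simp
    have h4 : τ * (γ * (j + 1)) = Real.log 2 / 4 * (j + 1) := by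
      rw [hγ]
      field_simp
    rw [mul_add, h3, add_comm 1 (j : ℝ)] at h2
    refine le_of_mul_le_mul_left ?_ hτ
    rw [h4]
    nlinarith
  have hle : ((γ : ℝ) : EReal) ≤ alphaStar a :=
    le_liminf_of_le (by isBoundedDefault) (hev.mono fun j hj => EReal.coe_le_coe_iff.mpr hj)
  exact lt_of_lt_of_le (by exact_mod_cast hγ0) hle

/-- If `a` grows at least like `exp (α j)`, at most `log T / α + O(1)` of the factors of `boxCard`
exceed one. Each of them costs a factor three, hence the contribution `log 3 / α` to the
exponent. -/
theorem mem_sptExponents {a₀ β : ℝ} (ha₀ : 0 < a₀) (ha : ∀ j, a₀ ≤ a j) (hβ : 0 < β)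
    (hb : ∀ j, β ≤ b j) (ω : Set.Ioo (0 : ℝ) 1) (Λ : InfoClass) (crit : Criterion)
    (hB : Summable fun j => 1 / b j) {α : ℝ} (hα : 0 < α) (hlt : (α : EReal) < alphaStar a) :
    ∑' j, 1 / b j + Real.log 3 / α ∈ sptExponents Λ crit ω a b := by
  have hd := decay_pos ω
  have hapos : ∀ j, 0 < a j := fun j => ha₀.trans_le (ha j)
  have hbpos : ∀ j, 0 < b j := fun j => hβ.trans_le (hb j)
  have hlog3 : 0 < Real.log 3 := Real.log_pos (by norm_num)
  have hBpos := tsum_one_div_pos hbpos hB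
  set B := ∑' j, 1 / b j with hBdef
  have hev : ∀ᶠ j : ℕ in atTop, α * ((j : ℝ) + 1) < Real.log (a j) := by
    filter_upwards [eventually_lt_of_lt_liminf hlt (by isBoundedDefault)] with j hj
    rw [EReal.coe_lt_coe_iff, lt_div_iff₀ (by positivity)] at hj
    exact hj
  obtain ⟨J, hJ⟩ := eventually_atTop.mp hev
  obtain ⟨D, hD0, hD⟩ := exists_minError_boxCard_le ha₀ ha hβ hb ω Λ
  have hsum : Summable fun j => Real.exp (-(decay ω / 2 * a j)) := by
    have h1 := summable_exp_neg_mul_rpow (mul_pos (half_pos hd) hα) one_pos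
    refine Summable.of_norm_bounded_eventually_nat h1 ?_
    filter_upwards [hev] with j hj
    rw [Real.norm_eq_abs, abs_of_pos (Real.exp_pos _), Real.exp_le_exp, Real.rpow_one]
    have h2 : α * j ≤ a j := by
      have := Real.log_le_sub_one_of_pos (hapos j)
      nlinarith
    have := mul_le_mul_of_nonneg_left h2 (half_pos hd).le
    linarith
  set A := ∑' j, Real.exp (-(decay ω / 2 * a j)) with hA
  have hA0 : 0 ≤ A := tsum_nonneg fun _ => (Real.exp_pos _).le
  have hlog2 : 0 < Real.log 2 := Real.log_pos one_lt_two
  set K := 1 + a₀ + 4 / decay ω * (1 + Real.log 2 + D * A) with hK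
  have hK1 : 1 ≤ K := by
    have : 0 ≤ 4 / decay ω * (1 + Real.log 2 + D * A) := by positivity
    linarith
  have hKa : a₀ ≤ K := by
    have : 0 ≤ 4 / decay ω * (1 + Real.log 2 + D * A) := by positivity
    linarith
  refine ⟨by positivity, 3 ^ J * K ^ (Real.log 3 / α) * (K / a₀) ^ B, by positivity,
    fun s hs ε hε => ?_⟩
  set x := Real.log ε⁻¹ with hx
  have hx0 : 0 < x := Real.log_pos ((one_lt_inv₀ hε.1).mpr hε.2)
  set T := K * (1 + x) with hT
  have hT1 : 1 ≤ T := one_le_mul_of_one_le_of_one_le hK1 (by linarith)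
  have hTa : a₀ ≤ T := hKa.trans (le_mul_of_one_le_right (by linarith) (by linarith))
  have hn : infoComplexity Λ crit ω a b ε s ≤ boxCard a b T s := by
    refine infoComplexity_le ha₀ ha hβ hb crit ((hD s T).trans (ENNReal.ofReal_le_ofReal ?_))
    have h1 : D * ∑ j ∈ Finset.range s, Real.exp (-(decay ω / 2 * a j)) ≤ D * A :=
      mul_le_mul_of_nonneg_left (hsum.sum_le_tsum _ fun _ _ => (Real.exp_pos _).le) hD0
    have h2 : x + Real.log 2 + D * A ≤ decay ω * T / 4 := by
      have h3 : 4 / decay ω * (1 + Real.log 2 + D * A) * (1 + x) ≤ T := by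
        rw [hT, hK]
        nlinarith
      have h4 : 4 / decay ω * (1 + Real.log 2 + D * A) * (1 + x) =
          4 * ((1 + Real.log 2 + D * A) * (1 + x)) / decay ω := by ring
      rw [h4, div_le_iff₀ hd] at h3
      have h5 : x + Real.log 2 + D * A ≤ (1 + Real.log 2 + D * A) * (1 + x) := by
        have : 0 ≤ (Real.log 2 + D * A) * x := by positivity
        nlinarith
      linarith
    calc 2 * Real.exp (D * ∑ j ∈ Finset.range s, Real.exp (-(decay ω / 2 * a j)) -
          decay ω * T / 4) ≤ 2 * Real.exp (-x + -Real.log 2) := by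
          gcongr
          linarith
      _ = ε := by
          rw [Real.exp_add, Real.exp_neg (Real.log 2), Real.exp_log two_pos, hx, Real.log_inv,
            neg_neg, Real.exp_log hε.1]
          ring
  have hcount : (((Finset.range s).filter fun j => a j ≤ T).card : ℝ) ≤
      J + Real.log T / α := by
    have hsub : ((Finset.range s).filter fun j => a j ≤ T) ⊆
        Finset.range (J + ⌊Real.log T / α⌋₊) := by
      intro j hj
      rw [Finset.mem_range]
      by_contra! hge
      have h1 := hJ j (by omega)
      have h2 := Real.log_le_log (hapos j) (Finset.mem_filter.mp hj).2
      have h3 : ((j + 1 : ℕ) : ℝ) ≤ Real.log T / α := by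
        rw [le_div_iff₀ hα]
        push_cast
        linarith
      have h4 := Nat.le_floor h3
      omega
    have h1 := Finset.card_le_card hsub
    rw [Finset.card_range] at h1
    have h2 : (⌊Real.log T / α⌋₊ : ℝ) ≤ Real.log T / α :=
      Nat.floor_le (div_nonneg (Real.log_nonneg hT1) hα.le)
    have h3 : (((Finset.range s).filter fun j => a j ≤ T).card : ℝ) ≤
        J + (⌊Real.log T / α⌋₊ : ℝ) := by exact_mod_cast h1
    linarith
  have hpow : (3 : ℝ) ^ ((Finset.range s).filter fun j => a j ≤ T).card ≤
      3 ^ J * T ^ (Real.log 3 / α) := by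
    have hT0 : 0 < T := by linarith
    calc (3 : ℝ) ^ ((Finset.range s).filter fun j => a j ≤ T).card
        = (3 : ℝ) ^ (((Finset.range s).filter fun j => a j ≤ T).card : ℝ) :=
          (Real.rpow_natCast _ _).symm
      _ ≤ (3 : ℝ) ^ ((J : ℝ) + Real.log T / α) :=
          Real.rpow_le_rpow_of_exponent_le (by norm_num) hcount
      _ = 3 ^ J * T ^ (Real.log 3 / α) := by
          rw [Real.rpow_add (by norm_num), Real.rpow_natCast, Real.rpow_def_of_pos (by norm_num),
            Real.rpow_def_of_pos hT0]
          congr 2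
          ring
  have hTB : (T / a₀) ^ (∑ j ∈ Finset.range s, 1 / b j) ≤ (T / a₀) ^ B :=
    Real.rpow_le_rpow_of_exponent_le ((one_le_div ha₀).mpr hTa)
      (sum_range_le_tsum_one_div hbpos hB s)
  calc (infoComplexity Λ crit ω a b ε s : ℝ) ≤ boxCard a b T s := by exact_mod_cast hn
    _ ≤ _ := boxCard_le ha₀ ha hbpos hTa s
    _ ≤ 3 ^ J * T ^ (Real.log 3 / α) * (T / a₀) ^ B := by
        have hT0 : 0 < T := by linarith
        gcongr
    _ = _ := by
        have h1x : 0 < 1 + x := by linarith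
        have e : T / a₀ = K / a₀ * (1 + x) := by
          rw [hT]
          ring
        rw [e, hT, Real.mul_rpow (by positivity) h1x.le, Real.mul_rpow (by positivity) h1x.le,
          Real.rpow_add h1x]
        ring

theorem ecspt_of_alphaStar_pos {a₀ β : ℝ} (ha₀ : 0 < a₀) (ha : ∀ j, a₀ ≤ a j) (hβ : 0 < β)
    (hb : ∀ j, β ≤ b j) (ω : Set.Ioo (0 : ℝ) 1) (Λ : InfoClass) (crit : Criterion)
    (hB : Summable fun j => 1 / b j) (hα : 0 < alphaStar a) : ECSPT Λ crit ω a b := by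
  obtain ⟨α, h1, h2⟩ := EReal.lt_iff_exists_real_btwn.mp hα
  exact ⟨_, mem_sptExponents ha₀ ha hβ hb ω Λ crit hB (by exact_mod_cast h1) h2⟩

theorem ecpt_of_ecspt {Λ : InfoClass} {crit : Criterion} (h : ECSPT Λ crit ω a b) :
    ECPT Λ crit ω a b := by
  obtain ⟨τ, hτ, c, hc, H⟩ := h
  exact ⟨c, 0, τ, hc, le_rfl, hτ, fun s hs ε hε => by simpa using H s hs ε hε⟩

theorem tsum_le_tauStar {a₀ β : ℝ} (ha₀ : 0 < a₀) (ha : ∀ j, a₀ ≤ a j) (hβ : 0 < β)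
    (hb : ∀ j, β ≤ b j) {Λ : InfoClass} {crit : Criterion} (h : ECSPT Λ crit ω a b) :
    ∑' j, 1 / b j ≤ tauStar Λ crit ω a b :=
  le_csInf h fun _ hτ => tsum_le_of_mem_sptExponents ha₀ ha hβ hb hτ

theorem tauStar_le {a₀ β : ℝ} (ha₀ : 0 < a₀) (ha : ∀ j, a₀ ≤ a j) (hβ : 0 < β)
    (hb : ∀ j, β ≤ b j) (ω : Set.Ioo (0 : ℝ) 1) (Λ : InfoClass) (crit : Criterion)
    (hB : Summable fun j => 1 / b j) {α : ℝ} (hα : 0 < α) (hlt : (α : EReal) < alphaStar a) :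
    tauStar Λ crit ω a b ≤ ∑' j, 1 / b j + Real.log 3 / α :=
  csInf_le ⟨0, fun _ hτ => hτ.1⟩ (mem_sptExponents ha₀ ha hβ hb ω Λ crit hB hα hlt)

theorem tauStar_le_of_eq_top {a₀ β : ℝ} (ha₀ : 0 < a₀) (ha : ∀ j, a₀ ≤ a j) (hβ : 0 < β)
    (hb : ∀ j, β ≤ b j) (ω : Set.Ioo (0 : ℝ) 1) (Λ : InfoClass) (crit : Criterion)
    (hB : Summable fun j => 1 / b j) (htop : alphaStar a = ⊤) :
    tauStar Λ crit ω a b ≤ ∑' j, 1 / b j := by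
  have hlim : Tendsto (fun α : ℝ => ∑' j, 1 / b j + Real.log 3 / α) atTop
      (𝓝 (∑' j, 1 / b j + 0)) :=
    tendsto_const_nhds.add (tendsto_const_nhds.div_atTop tendsto_id)
  rw [add_zero] at hlim
  refine ge_of_tendsto hlim ((eventually_gt_atTop 0).mono fun α hα => ?_)
  exact tauStar_le ha₀ ha hβ hb ω Λ crit hB hα (htop ▸ EReal.coe_lt_top α)

theorem tauStar_le_of_eq_coe {a₀ β : ℝ} (ha₀ : 0 < a₀) (ha : ∀ j, a₀ ≤ a j) (hβ : 0 < β)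
    (hb : ∀ j, β ≤ b j) (ω : Set.Ioo (0 : ℝ) 1) (Λ : InfoClass) (crit : Criterion)
    (hB : Summable fun j => 1 / b j) {r : ℝ} (hr : 0 < r) (h : alphaStar a = r) :
    tauStar Λ crit ω a b ≤ ∑' j, 1 / b j + Real.log 3 / r := by
  have hlim : Tendsto (fun α : ℝ => ∑' j, 1 / b j + Real.log 3 / α) (𝓝[<] r)
      (𝓝 (∑' j, 1 / b j + Real.log 3 / r)) :=
    tendsto_const_nhds.add (tendsto_const_nhds.div (tendsto_id.mono_left nhdsWithin_le_nhds) hr.ne')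
  have hev : ∀ᶠ α in 𝓝[<] r, 0 < α := nhdsWithin_le_nhds (eventually_gt_nhds hr)
  refine ge_of_tendsto hlim ?_
  filter_upwards [hev, self_mem_nhdsWithin] with α hα hαr
  exact tauStar_le ha₀ ha hβ hb ω Λ crit hB hα (by rw [h]; exact_mod_cast hαr)

theorem tauStar_le_add_div {a₀ β : ℝ} (ha₀ : 0 < a₀) (ha : ∀ j, a₀ ≤ a j) (hβ : 0 < β)
    (hb : ∀ j, β ≤ b j) (ω : Set.Ioo (0 : ℝ) 1) (Λ : InfoClass) (crit : Criterion)
    (hB : Summable fun j => 1 / b j) (hα : 0 < alphaStar a) :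
    (tauStar Λ crit ω a b : EReal) ≤
      ((∑' j, 1 / b j : ℝ) : EReal) + ((Real.log 3 : ℝ) : EReal) / alphaStar a := by
  rcases eq_or_ne (alphaStar a) ⊤ with htop | htop
  · rw [htop, EReal.div_top, add_zero]
    exact_mod_cast tauStar_le_of_eq_top ha₀ ha hβ hb ω Λ crit hB htop
  · have hr : alphaStar a = ((alphaStar a).toReal : EReal) :=
      (EReal.coe_toReal htop (ne_bot_of_gt hα)).symm
    have hr0 : 0 < (alphaStar a).toReal := by
      rw [hr] at hα
      exact_mod_cast hα
    rw [hr, ← EReal.coe_div, ← EReal.coe_add, EReal.coe_le_coe_iff]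
    exact tauStar_le_of_eq_coe ha₀ ha hβ hb ω Λ crit hB hr0 hr

end Korobov

end

theorem theorem1 (ω : Set.Ioo (0 : ℝ) 1) (a b : ℕ → ℝ)
    (ha_pos : ∀ j, 0 < a j) (hb_pos : ∀ j, 0 < b j)
    (ha_inf : 0 < ⨅ j, a j) (hb_inf : 0 < ⨅ j, b j) (ha_mono : Monotone a)
    (Λ : Korobov.InfoClass) (crit : Korobov.Criterion) :
    -- 1. exponential convergence and its largest rate
    (Korobov.EXP Λ ω a b ∧
      ∀ s : ℕ, 1 ≤ s →
        IsLUB (Korobov.expRates Λ ω a b s) (1 / ∑ j ∈ Finset.range s, 1 / b j)) ∧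
    -- 2. uniform exponential convergence and its largest rate
    ((Korobov.UEXP Λ ω a b ↔ Summable fun j => 1 / b j) ∧
      ((Summable fun j => 1 / b j) →
        IsLUB (Korobov.uniformExpRates Λ ω a b) (1 / ∑' j, 1 / b j))) ∧
    -- 3. weak tractability
    (∀ κ : ℝ, 1 ≤ κ →
      (Korobov.KappaECWT Λ crit ω a b κ ↔ Tendsto a atTop atTop)) ∧
    -- 4. weak tractability with uniform exponential convergence
    (Korobov.ECWT Λ crit ω a b ∧ Korobov.UEXP Λ ω a b ↔
      (Summable fun j => 1 / b j) ∧ Tendsto a atTop atTop) ∧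
    -- 5. equivalence of the polynomial notions
    [Korobov.ECPT Λ crit ω a b,
      Korobov.ECPT Λ crit ω a b ∧ Korobov.EXP Λ ω a b,
      Korobov.ECPT Λ crit ω a b ∧ Korobov.UEXP Λ ω a b,
      Korobov.ECSPT Λ crit ω a b,
      Korobov.ECSPT Λ crit ω a b ∧ Korobov.EXP Λ ω a b,
      Korobov.ECSPT Λ crit ω a b ∧ Korobov.UEXP Λ ω a b].TFAE ∧
    -- 6. strong polynomial tractability and its exponent
    ((Korobov.ECSPT Λ crit ω a b ∧ Korobov.UEXP Λ ω a b ↔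
        (Summable fun j => 1 / b j) ∧ 0 < Korobov.alphaStar a) ∧
      ((Summable fun j => 1 / b j) ∧ 0 < Korobov.alphaStar a →
        (((∑' j, 1 / b j : ℝ) : EReal) ≤ (Korobov.tauStar Λ crit ω a b : EReal) ∧
          (Korobov.tauStar Λ crit ω a b : EReal) ≤
            ((∑' j, 1 / b j : ℝ) : EReal) + ((Real.log 3 : ℝ) : EReal) / Korobov.alphaStar a) ∧
        (Korobov.alphaStar a = ⊤ → Korobov.tauStar Λ crit ω a b = ∑' j, 1 / b j))) := by
  obtain ⟨a₀, ha₀, ha⟩ : ∃ a₀ : ℝ, 0 < a₀ ∧ ∀ j, a₀ ≤ a j :=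
    ⟨_, ha_inf, ciInf_le ⟨0, by rintro _ ⟨j, rfl⟩; exact (ha_pos j).le⟩⟩
  obtain ⟨β, hβ, hb⟩ : ∃ β : ℝ, 0 < β ∧ ∀ j, β ≤ b j :=
    ⟨_, hb_inf, ciInf_le ⟨0, by rintro _ ⟨j, rfl⟩; exact (hb_pos j).le⟩⟩
  have hexp : Korobov.EXP Λ ω a b := ⟨_, Korobov.isExpRate_one_div ha₀ ha hβ hb ω Λ⟩
  have huexp := Korobov.uexp_iff ha₀ ha hβ hb ω Λ
  have hwt : ∀ κ : ℝ, 1 ≤ κ → (Korobov.KappaECWT Λ crit ω a b κ ↔ Tendsto a atTop atTop) :=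
    fun κ hκ => ⟨Korobov.tendsto_of_kappaECWT ha₀ ha hβ hb ha_mono,
      fun h => Korobov.kappaECWT_of_tendsto ha₀ ha hβ hb h ω Λ crit hκ⟩
  have hpt : Korobov.ECPT Λ crit ω a b → (Summable fun j => 1 / b j) ∧ 0 < Korobov.alphaStar a :=
    fun h => ⟨Korobov.summable_of_ecpt ha₀ ha hβ hb h,
      Korobov.alphaStar_pos_of_ecpt ha₀ ha hβ hb ha_mono h⟩
  have hspt : (Summable fun j => 1 / b j) ∧ 0 < Korobov.alphaStar a → Korobov.ECSPT Λ crit ω a b :=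
    fun h => Korobov.ecspt_of_alphaStar_pos ha₀ ha hβ hb ω Λ crit h.1 h.2
  refine ⟨⟨hexp, fun s hs => Korobov.isLUB_expRates ha₀ ha hβ hb ω Λ hs⟩,
    ⟨huexp, Korobov.isLUB_uniformExpRates ha₀ ha hβ hb ω Λ⟩, hwt, ?_, ?_, ?_,
    fun h => ⟨⟨?_, ?_⟩, ?_⟩⟩
  · rw [huexp, and_comm]
    exact and_congr_right fun _ => hwt 1 le_rfl
  · tfae_have 1 → 6 := fun h => ⟨hspt (hpt h), huexp.mpr (hpt h).1⟩
    tfae_have 6 → 5 := fun h => ⟨h.1, hexp⟩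
    tfae_have 5 → 4 := fun h => h.1
    tfae_have 4 → 1 := Korobov.ecpt_of_ecspt
    tfae_have 1 → 3 := fun h => ⟨h, huexp.mpr (hpt h).1⟩
    tfae_have 3 → 2 := fun h => ⟨h.1, hexp⟩
    tfae_have 2 → 1 := fun h => h.1
    tfae_finish
  · exact ⟨fun h => hpt (Korobov.ecpt_of_ecspt h.1), fun h => ⟨hspt h, huexp.mpr h.1⟩⟩
  · exact_mod_cast Korobov.tsum_le_tauStar ha₀ ha hβ hb (hspt h)
  · exact Korobov.tauStar_le_add_div ha₀ ha hβ hb ω Λ crit h.1 h.2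
  · exact fun htop => le_antisymm (Korobov.tauStar_le_of_eq_top ha₀ ha hβ hb ω Λ crit h.1 htop)
      (Korobov.tsum_le_tauStar ha₀ ha hβ hb (hspt h))
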